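/- **Theorem.** Let $d\ge 1$ and let $p=1$ if $d=1$, $p>1$ if $d=2$, and $p=d/2$ if $d\ge 3$. Let $A:\mathbb{R}^d\to\mathbb{R}^d$ be a magnetic potential with $A\in W^{1,2p}_{\mathrm{loc}}(\mathbb{R}^d)$. Let $B:=\nabla A-(\nabla A)^T$, i.e. $B_{jk}=\partial_jA_k-\partial_kA_j$ in the sense of distributions, be the magnetic tensor, and let $|B(x)|$ denote the operator norm of the matrix $B(x)$ with respect to the Euclidean norm. For $\psi\in L^2(\mathbb{R}^d;\mathbb{C})$ let $\nabla_{\!A}\psi:=\nabla\psi-iA\psi$ in the sense of distributions, and let $$W^{1,2}_A(\mathbb{R}^d):=\{\psi\in L^2(\mathbb{R}^d):\nabla_{\!A}\psi\in L^2(\mathbb{R}^d)\}.$$ Suppose that there is a constant $0\le b<1$ such that $$\int_{\mathbb{R}^d}|x|^2\,|B|^2\,|\psi|^2\,dx\;\le\; b^2\int_{\mathbb{R}^d}|\nabla_{\!A}\psi|^2\,dx\qquad\text{for all }\psi\in W^{1,2}_A(\mathbb{R}^d).$$ Let $H_{A,0}=(-i\nabla-A)^2$ be the magnetic Laplacian,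 that is, the self-adjoint operator in $L^2(\mathbb{R}^d)$ associated with the quadratic form $\psi\mapsto\int|\nabla_{\!A}\psi|^2$ with form domain $W^{1,2}_A(\mathbb{R}^d)$: one has $\psi\in\operatorname{Dom}(H_{A,0})$ and $H_{A,0}\psi=\eta\in L^2(\mathbb{R}^d)$ if and only if $\psi\in W^{1,2}_A(\mathbb{R}^d)$ and $(\nabla_{\!A}\phi,\nabla_{\!A}\psi)=(\phi,\eta)$ for all $\phi\in W^{1,2}_A(\mathbb{R}^d)$. Then $H_{A,0}$ has no eigenvalues, i.e. $\sigma_{\mathrm p}(H_{A,0})=\varnothing$. -/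

import Mathlib

open MeasureTheory
open scoped ENNReal ContDiff InnerProductSpace

noncomputable section

namespace MagneticLaplacian

/-- The Euclidean space of dimension `d`. -/
abbrev Space (d : ℕ) : Type := EuclideanSpace ℝ (Fin d)

/-- The Hilbert space of complex-valued square-integrable functions. -/
abbrev L2 (d : ℕ) : Type := Lp ℂ 2 (volume : Measure (Space d))

/-- The Hilbert space of square-integrable fields with values in `ℂ ^ d`. -/
abbrev L2Vec (d : ℕ) : Type := Lp (EuclideanSpace ℂ (Fin d)) 2 (volume : Measure (Space d))

/-- The locally integrable function `g` is the `j`-th partial derivative of the locally integrable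
function `f` in the sense of distributions. -/
structure HasWeakPartialDeriv {d : ℕ} {F : Type*} [NormedAddCommGroup F] [NormedSpace ℝ F]
    (j : Fin d) (f g : Space d → F) : Prop where
  locallyIntegrable_fun : LocallyIntegrable f volume
  locallyIntegrable_deriv : LocallyIntegrable g volume
  integral_eq : ∀ φ : Space d → ℝ, ContDiff ℝ ∞ φ → HasCompactSupport φ →
    ∫ x, fderiv ℝ φ x (EuclideanSpace.single j 1) • f x = -∫ x, φ x • g x

open Classical in
/-- The `j`-th weak partial derivative of `f`; it is unique up to equality almost everywhere if it
exists (junk value `0` if it does not exist). -/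
def weakPartialDeriv {d : ℕ} (j : Fin d) (f : Space d → ℝ) : Space d → ℝ :=
  if h : ∃ g, HasWeakPartialDeriv j f g then h.choose else 0

/-- Membership in `L^q_loc`. -/
def MemLpLoc {d : ℕ} {F : Type*} [NormedAddCommGroup F] (f : Space d → F) (q : ℝ≥0∞) : Prop :=
  ∀ K : Set (Space d), IsCompact K → MemLp f q (volume.restrict K)

/-- Membership in `W^{1,q}_loc` of a vector field `A`: all its components and all their weak
partial derivatives belong to `L^q_loc`. -/
def MemW1Loc {d : ℕ} (A : Space d → Space d) (q : ℝ≥0∞) : Prop :=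
  ∀ k : Fin d, MemLpLoc (fun x => A x k) q ∧
    ∀ j : Fin d, ∃ g : Space d → ℝ, HasWeakPartialDeriv j (fun x => A x k) g ∧ MemLpLoc g q

/-- The magnetic tensor `B = ∇A - (∇A)ᵀ`, with entries `B_{jk} = ∂_j A_k - ∂_k A_j`. -/
def magneticTensor {d : ℕ} (A : Space d → Space d) (x : Space d) : Matrix (Fin d) (Fin d) ℝ :=
  Matrix.of fun j k =>
    weakPartialDeriv j (fun y => A y k) x - weakPartialDeriv k (fun y => A y j) x

/-- The operator norm `|B(x)|` of the magnetic tensor with respect to the Euclidean norm. -/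
def magneticTensorNorm {d : ℕ} (A : Space d → Space d) (x : Space d) : ℝ :=
  ‖Matrix.toEuclideanCLM (n := Fin d) (𝕜 := ℝ) (magneticTensor A x)‖

/-- The field `G` is the magnetic gradient `∇_A ψ = ∇ψ - i A ψ` of `ψ` in the sense of
distributions, that is, `∂_j ψ = G_j + i A_j ψ` for every `j`. -/
def HasMagneticGradient {d : ℕ} (A : Space d → Space d) (ψ : L2 d) (G : L2Vec d) : Prop :=
  ∀ j : Fin d, HasWeakPartialDeriv j (ψ : Space d → ℂ)
    (fun x => G x j + Complex.I * (A x j : ℂ) * ψ x)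

section WeakDerivatives

variable {d : ℕ} {F : Type*} [NormedAddCommGroup F] [NormedSpace ℝ F] {j : Fin d}
  {f f' g g' : Space d → F}

theorem integrable_test {h : Space d → F} {φ : Space d → ℝ} (hh : LocallyIntegrable h volume)
    (hφ : Continuous φ) (hφc : HasCompactSupport φ) : Integrable (fun x => φ x • h x) volume :=
  hh.integrable_smul_left_of_hasCompactSupport hφ hφc

theorem continuous_partial {φ : Space d → ℝ} (hφ : ContDiff ℝ ∞ φ) (j : Fin d) :
    Continuous fun x => fderiv ℝ φ x (EuclideanSpace.single j 1) :=
  (hφ.continuous_fderiv (by simp)).clm_apply continuous_const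

theorem hasCompactSupport_partial {φ : Space d → ℝ} (hφ : HasCompactSupport φ) (j : Fin d) :
    HasCompactSupport fun x => fderiv ℝ φ x (EuclideanSpace.single j 1) :=
  hφ.fderiv_apply (𝕜 := ℝ) _

theorem HasWeakPartialDeriv.add (h : HasWeakPartialDeriv j f g)
    (h' : HasWeakPartialDeriv j f' g') :
    HasWeakPartialDeriv j (fun x => f x + f' x) (fun x => g x + g' x) := by
  refine ⟨h.1.add h'.1, h.2.add h'.2, fun φ hφ hφc => ?_⟩
  have c1 := continuous_partial hφ j
  have c2 := hasCompactSupport_partial hφc j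
  simp only [smul_add]
  rw [integral_add (integrable_test h.1 c1 c2) (integrable_test h'.1 c1 c2),
    integral_add (integrable_test h.2 hφ.continuous hφc)
      (integrable_test h'.2 hφ.continuous hφc), h.3 φ hφ hφc, h'.3 φ hφ hφc]
  abel

theorem HasWeakPartialDeriv.const_mul {f g : Space d → ℂ} (c : ℂ)
    (h : HasWeakPartialDeriv j f g) :
    HasWeakPartialDeriv j (fun x => c * f x) (fun x => c * g x) := by
  refine ⟨h.1.smul c, h.2.smul c, fun φ hφ hφc => ?_⟩
  have e (r : ℝ) (z : ℂ) : r • (c * z) = c * (r • z) := (mul_smul_comm r c z).symm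
  simp only [e]
  rw [integral_const_mul, integral_const_mul, h.3 φ hφ hφc]
  ring

theorem HasWeakPartialDeriv.congr_ae (h : HasWeakPartialDeriv j f g)
    (hf : f =ᵐ[volume] f') (hg : g =ᵐ[volume] g') : HasWeakPartialDeriv j f' g' := by
  refine ⟨h.1.congr hf, h.2.congr hg, fun φ hφ hφc => ?_⟩
  have e1 : ∫ x, fderiv ℝ φ x (EuclideanSpace.single j 1) • f' x =
      ∫ x, fderiv ℝ φ x (EuclideanSpace.single j 1) • f x :=
    integral_congr_ae (hf.mono fun x hx => congrArg (_ • ·) hx.symm)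
  have e2 : ∫ x, φ x • g' x = ∫ x, φ x • g x :=
    integral_congr_ae (hg.mono fun x hx => congrArg (_ • ·) hx.symm)
  rw [e1, e2, h.3 φ hφ hφc]

theorem HasWeakPartialDeriv.of_zero [CompleteSpace F] (h : HasWeakPartialDeriv j f g)
    (hf : f =ᵐ[volume] 0) : g =ᵐ[volume] 0 := by
  refine ae_eq_zero_of_integral_contDiff_smul_eq_zero h.2 fun φ hφ hφc => ?_
  have := h.3 φ hφ hφc
  rw [integral_eq_zero_of_ae (hf.mono fun x hx => by simp [hx])] at this
  simpa using this.symm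

end WeakDerivatives

/-- The graph of the magnetic gradient. -/
def magneticGradientGraph {d : ℕ} (A : Space d → Space d) : Submodule ℂ (L2 d × L2Vec d) where
  carrier := {z | HasMagneticGradient A z.1 z.2}
  zero_mem' := fun j => by
    have h0 : HasWeakPartialDeriv j (fun _ : Space d => (0 : ℂ)) (fun _ => 0) :=
      ⟨locallyIntegrable_const 0, locallyIntegrable_const 0, by simp⟩
    refine h0.congr_ae (Lp.coeFn_zero ℂ 2 volume).symm ?_
    filter_upwards [Lp.coeFn_zero ℂ 2 (volume : Measure (Space d)),
      Lp.coeFn_zero (EuclideanSpace ℂ (Fin d)) 2 (volume : Measure (Space d))] with x h1 h2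
    simp only [Prod.fst_zero, Prod.snd_zero, h1, h2, Pi.zero_apply, PiLp.zero_apply, mul_zero,
      add_zero]
  add_mem' := fun {z w} hz hw j => by
    refine ((hz j).add (hw j)).congr_ae (Lp.coeFn_add z.1 w.1).symm ?_
    filter_upwards [Lp.coeFn_add z.1 w.1, Lp.coeFn_add z.2 w.2] with x h1 h2
    simp only [Prod.fst_add, Prod.snd_add, h1, h2, Pi.add_apply, PiLp.add_apply]
    ring
  smul_mem' := fun c z hz j => by
    refine ((hz j).const_mul c).congr_ae (Lp.coeFn_smul c z.1).symm ?_
    filter_upwards [Lp.coeFn_smul c z.1, Lp.coeFn_smul c z.2] with x h1 h2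
    simp only [Prod.smul_fst, Prod.smul_snd, h1, h2, Pi.smul_apply, PiLp.smul_apply, smul_eq_mul]
    ring

theorem magneticGradientGraph_single_valued {d : ℕ} (A : Space d → Space d)
    (z : L2 d × L2Vec d) (hz : z ∈ magneticGradientGraph A) (hz0 : z.1 = 0) : z.2 = 0 := by
  have h1 : (z.1 : Space d → ℂ) =ᵐ[volume] 0 := hz0 ▸ Lp.coeFn_zero ℂ 2 volume
  have h2 : ∀ᵐ x, ∀ j : Fin d, z.2 x j + Complex.I * (A x j : ℂ) * z.1 x = 0 :=
    ae_all_iff.2 fun j => (hz j).of_zero h1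
  rw [Lp.eq_zero_iff_ae_eq_zero]
  filter_upwards [h1, h2] with x hx1 hx2
  ext j
  simpa [hx1] using hx2 j

/-- The magnetic gradient `∇_A = ∇ - i A` as an unbounded operator; its domain is the magnetic
Sobolev space `W_A^{1,2} = {ψ ∈ L² : ∇_A ψ ∈ L²}`. -/
def magneticGradient {d : ℕ} (A : Space d → Space d) : L2 d →ₗ.[ℂ] L2Vec d :=
  (magneticGradientGraph A).toLinearPMap

theorem mem_magneticGradient_graph_iff {d : ℕ} (A : Space d → Space d) (ψ : L2 d) (G : L2Vec d) :
    (ψ, G) ∈ (magneticGradient A).graph ↔ HasMagneticGradient A ψ G := by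
  rw [magneticGradient, Submodule.toLinearPMap_graph_eq _ (magneticGradientGraph_single_valued A)]
  exact Iff.rfl

/-- The graph of the operator associated with the quadratic form `ψ ↦ ‖∇_A ψ‖²` with form domain
`W_A^{1,2}`: the pair `(ψ, η)` belongs to it if and only if `ψ ∈ W_A^{1,2}` and
`(∇_A φ, ∇_A ψ) = (φ, η)` for all `φ ∈ W_A^{1,2}`. -/
def magneticLaplacianGraph {d : ℕ} (A : Space d → Space d) : Submodule ℂ (L2 d × L2 d) where
  carrier := {z | ∃ hz : z.1 ∈ (magneticGradient A).domain,
    ∀ φ : (magneticGradient A).domain,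
      ⟪magneticGradient A φ, magneticGradient A ⟨z.1, hz⟩⟫_ℂ = ⟪(φ : L2 d), z.2⟫_ℂ}
  zero_mem' := ⟨Submodule.zero_mem _, fun φ => by
    have : (⟨0, Submodule.zero_mem _⟩ : (magneticGradient A).domain) = 0 := rfl
    simp [this]⟩
  add_mem' := by
    rintro z w ⟨hz, hz'⟩ ⟨hw, hw'⟩
    refine ⟨Submodule.add_mem _ hz hw, fun φ => ?_⟩
    have : (⟨(z + w).1, Submodule.add_mem _ hz hw⟩ : (magneticGradient A).domain) =
      ⟨z.1, hz⟩ + ⟨w.1, hw⟩ := rfl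
    rw [this, LinearPMap.map_add, inner_add_right, hz', hw', Prod.snd_add, inner_add_right]
  smul_mem' := by
    rintro c z ⟨hz, hz'⟩
    refine ⟨Submodule.smul_mem _ c hz, fun φ => ?_⟩
    have : (⟨(c • z).1, Submodule.smul_mem _ c hz⟩ : (magneticGradient A).domain) =
      c • ⟨z.1, hz⟩ := rfl
    rw [this, LinearPMap.map_smul, inner_smul_right, hz', Prod.smul_snd, inner_smul_right]

/-- Test functions belong to `W_A^{1,2}` if `A` is locally square integrable. -/
theorem test_mem_magneticGradient_domain {d : ℕ} {A : Space d → Space d}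
    (hA : ∀ k : Fin d, MemLpLoc (fun x => A x k) 2) {g : Space d → ℝ} (hg : ContDiff ℝ ∞ g)
    (hgc : HasCompactSupport g) (hgL : MemLp (fun x => (g x : ℂ)) 2 volume) :
    hgL.toLp _ ∈ (magneticGradient A).domain := by
  have hAg (j : Fin d) : MemLp (fun x => Complex.I * (A x j : ℂ) * (g x : ℂ)) 2 volume := by
    obtain ⟨C, hC⟩ := hgc.exists_bound_of_continuous hg.continuous
    have hK := hA j (tsupport g) hgc
    have h1 : MemLp (fun x => Complex.I * (A x j : ℂ) * (g x : ℂ)) 2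
        (volume.restrict (tsupport g)) := by
      refine MemLp.of_le_mul (c := C) hK ?_ (Filter.Eventually.of_forall fun x => ?_)
      · exact ((Complex.continuous_ofReal.comp_aestronglyMeasurable hK.1).const_mul _).mul
          (Complex.continuous_ofReal.comp hg.continuous).aestronglyMeasurable
      · rw [norm_mul, norm_mul, Complex.norm_I, one_mul, Complex.norm_real, Complex.norm_real,
          mul_comm]
        exact mul_le_mul_of_nonneg_right (hC x) (norm_nonneg _)
    rw [← memLp_indicator_iff_restrict (isClosed_tsupport g).measurableSet] at h1
    rwa [Set.indicator_eq_self.2] at h1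
    intro x hx
    refine subset_tsupport g ?_
    contrapose! hx
    simpa using fun _ => hx
  have hDg (j : Fin d) :
      MemLp (fun x => (fderiv ℝ g x (EuclideanSpace.single j 1) : ℂ)) 2 volume :=
    (Complex.continuous_ofReal.comp (continuous_partial hg j)).memLp_of_hasCompactSupport
      ((hasCompactSupport_partial hgc j).comp_left Complex.ofReal_zero)
  let G : Space d → EuclideanSpace ℂ (Fin d) := fun x => WithLp.toLp 2 fun j =>
    (fderiv ℝ g x (EuclideanSpace.single j 1) : ℂ) - Complex.I * (A x j : ℂ) * (g x : ℂ)
  have hG : MemLp G 2 volume := MemLp.of_eval_piLp fun j => (hDg j).sub (hAg j)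
  have key : HasMagneticGradient A (hgL.toLp _) (hG.toLp _) := by
    intro j
    have h0 : HasWeakPartialDeriv j (fun x => (g x : ℂ))
        (fun x => (fderiv ℝ g x (EuclideanSpace.single j 1) : ℂ)) := by
      refine ⟨hgL.locallyIntegrable (by norm_num), (hDg j).locallyIntegrable (by norm_num),
        fun φ hφ hφc => ?_⟩
      have hr : ∫ x, fderiv ℝ φ x (EuclideanSpace.single j 1) * g x =
          -∫ x, φ x * fderiv ℝ g x (EuclideanSpace.single j 1) := by
        rw [integral_mul_fderiv_eq_neg_fderiv_mul_of_integrable, neg_neg]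
        · exact ((continuous_partial hφ j).mul hg.continuous).integrable_of_hasCompactSupport
            hgc.mul_left
        · exact (hφ.continuous.mul (continuous_partial hg j)).integrable_of_hasCompactSupport
            hφc.mul_right
        · exact (hφ.continuous.mul hg.continuous).integrable_of_hasCompactSupport hφc.mul_right
        · exact fun x _ => hφ.differentiable (by simp) x
        · exact fun x _ => hg.differentiable (by simp) x
      simp only [Complex.real_smul, ← Complex.ofReal_mul, integral_complex_ofReal]
      rw [hr, Complex.ofReal_neg]
    refine h0.congr_ae hgL.coeFn_toLp.symm ?_
    filter_upwards [hgL.coeFn_toLp, hG.coeFn_toLp] with x h1 h2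
    simp [h1, h2, G]
  exact LinearPMap.mem_domain_of_mem_graph ((mem_magneticGradient_graph_iff A _ _).2 key)

theorem magneticLaplacianGraph_single_valued {d : ℕ} {A : Space d → Space d}
    (hA : ∀ k : Fin d, MemLpLoc (fun x => A x k) 2)
    (z : L2 d × L2 d) (hz : z ∈ magneticLaplacianGraph A) (hz0 : z.1 = 0) : z.2 = 0 := by
  obtain ⟨hd, h⟩ := hz
  have e : (⟨z.1, hd⟩ : (magneticGradient A).domain) = 0 := Subtype.ext hz0
  rw [Lp.eq_zero_iff_ae_eq_zero]
  refine ae_eq_zero_of_integral_contDiff_smul_eq_zero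
    ((Lp.memLp z.2).locallyIntegrable (by norm_num)) fun g hg hgc => ?_
  have hgL : MemLp (fun x => (g x : ℂ)) 2 volume :=
    (Complex.continuous_ofReal.comp hg.continuous).memLp_of_hasCompactSupport
      (hgc.comp_left Complex.ofReal_zero)
  have := h ⟨_, test_mem_magneticGradient_domain hA hg hgc hgL⟩
  rw [e, LinearPMap.map_zero, inner_zero_right, L2.inner_def] at this
  rw [this]
  refine integral_congr_ae ?_
  filter_upwards [hgL.coeFn_toLp] with x hx
  simp [hx, mul_comm]

/-- The magnetic Laplacian `H_{A,0} = (-i∇ - A)²`, the operator in `L²` associated with the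
quadratic form `ψ ↦ ‖∇_A ψ‖²` with form domain `W_A^{1,2}`. -/
def magneticLaplacian {d : ℕ} (A : Space d → Space d) : L2 d →ₗ.[ℂ] L2 d :=
  (magneticLaplacianGraph A).toLinearPMap

theorem mem_magneticLaplacian_graph_iff {d : ℕ} {A : Space d → Space d}
    (hA : ∀ k : Fin d, MemLpLoc (fun x => A x k) 2) (ψ η : L2 d) :
    (ψ, η) ∈ (magneticLaplacian A).graph ↔ ∃ hψ : ψ ∈ (magneticGradient A).domain,
      ∀ φ : (magneticGradient A).domain,
        ⟪magneticGradient A φ, magneticGradient A ⟨ψ, hψ⟩⟫_ℂ = ⟪(φ : L2 d), η⟫_ℂ := by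
  rw [magneticLaplacian,
    Submodule.toLinearPMap_graph_eq _ (magneticLaplacianGraph_single_valued hA)]
  exact Iff.rfl

/-- The point spectrum (the set of all eigenvalues) of an unbounded operator. -/
def pointSpectrum {H : Type*} [AddCommGroup H] [Module ℂ H] (T : H →ₗ.[ℂ] H) : Set ℂ :=
  {lam | ∃ ψ : T.domain, (ψ : H) ≠ 0 ∧ T ψ = lam • (ψ : H)}

/-- The smallness condition: there is `b < 1` such that
`∫ |x|² |B|² |ψ|² ≤ b² ∫ |∇_A ψ|²` for every `ψ ∈ W_A^{1,2}`. -/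
def SmallMagneticField {d : ℕ} (A : Space d → Space d) : Prop :=
  ∃ b : ℝ, 0 ≤ b ∧ b < 1 ∧ ∀ ψ : (magneticGradient A).domain,
    ∫⁻ x, ENNReal.ofReal (‖x‖ ^ 2 * magneticTensorNorm A x ^ 2 * ‖(ψ : L2 d) x‖ ^ 2) ≤
      ENNReal.ofReal (b ^ 2) * ∫⁻ x, ENNReal.ofReal (‖magneticGradient A ψ x‖ ^ 2)

/-- The admissible exponents: `p = 1` if `d = 1`, `p > 1` if `d = 2`, `p = d / 2` if `d ≥ 3`. -/
def AdmissibleExponent (d : ℕ) (p : ℝ) : Prop :=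
  (d = 1 ∧ p = 1) ∨ (d = 2 ∧ 1 < p) ∨ (3 ≤ d ∧ p = (d : ℝ) / 2)

end MagneticLaplacian

end

/-! The proof is a virial argument with finite dilations in place of their generator. Formally,
commuting the Laplacian with the generator of dilations would give `2‖∇_A ψ‖²` plus a term with the
field `xᵀB`, and the hypothesis makes that term smaller than the first. An eigenfunction need not
lie in the domain of the generator, so the identity is run with unitary dilations `D_r`, and `r → 1`
is taken only at the end.

A plain dilation does not respect `A`. The remedy is the phase `θ_r(x)`, the circulation of `A` from
`x` to `r x`, put into `D_r u = r^(d/2) e^(-iθ_r) u(r ·)`. Since `∇θ_r = r A(r x) - A(x) - β_r`,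
with `β_r(x) = ∫_1^r (xᵀB)(ρ x) dρ` and `(xᵀB)(ρ x)` the field evaluated at `ρ x`
(`IsRegularPotential.hasWeakPartialDeriv_gaugePhase`), one gets `∇_A D_r u = r D_r ∇_A u + i β_r D_r
u` (`IsRegularPotential.hasMagGrad_dilate`): the commutator sees `A` only through `xᵀB`.

Cauchy-Schwarz in `ρ` and the substitution `y = ρ x` bound `‖β_r D_r u‖` by `|r - 1| σ`, where `σ`
is the supremum of `‖|xᵀB| D_q u‖` over `q` near `1`. The smallness hypothesis applied to `D_q u`
gives `σ ≤ b (r₀ ‖∇_A u‖ + (r₀ - 1) σ)`, and `σ` can be absorbed if it is finite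
(`eLpNorm_dilationError_le_of_small`). Finiteness is clear for bounded `u` of compact support; the
resulting bound does not involve the size or support of `u`, so density removes the restriction.

Let `ψ` be an eigenfunction with eigenvalue `λ` and `G = ∇_A ψ`. Testing its equation with `D_r ψ`
gives `r Re⟨D_r G, G⟩ - λ Re⟨D_r ψ, ψ⟩ = O(|r - 1|)` with an explicit constant (`abs_virial_le`). As
the adjoint of `D_r` is `D_{1/r}`, both real parts are unchanged under `r ↦ 1/r`. Subtracting the
two relations removes `λ` and leaves a factor `r - 1/r` on each side; dividing by it and letting `r
→ 1` yields `‖G‖² ≤ b ‖G‖²`, so `G = 0` (`magGrad_eq_zero_of_eigenfunction`). Then `|ψ|` has zero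
gradient, and square integrability forces `ψ = 0` (`HasMagGrad.ae_eq_zero`). -/

noncomputable section

namespace MagneticLaplacian

open Filter Topology
open scoped Convolution

/-! ### Mollification and local `L¹` convergence. -/

section Mollifier

variable {d : ℕ} {F : Type*} [NormedAddCommGroup F] [NormedSpace ℝ F]

/-- A sequence of bump functions concentrating at the origin. -/
def bump (d n : ℕ) : ContDiffBump (0 : Space d) where
  rIn := 1 / (2 * ((n : ℝ) + 1))
  rOut := 1 / ((n : ℝ) + 1)
  rIn_pos := by positivity
  rIn_lt_rOut := by
    apply one_div_lt_one_div_of_lt <;> linarith [(n.cast_nonneg : (0 : ℝ) ≤ n)]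

/-- The standard mollifications of a locally integrable function. -/
def mollify (n : ℕ) (f : Space d → F) : Space d → F :=
  (bump d n).normed volume ⋆[ContinuousLinearMap.lsmul ℝ ℝ, volume] f

theorem tendsto_bump_rOut (d : ℕ) : Tendsto (fun n => (bump d n).rOut) atTop (𝓝 0) :=
  tendsto_one_div_add_atTop_nhds_zero_nat

theorem mollify_apply (n : ℕ) (f : Space d → F) (x : Space d) :
    mollify n f x = ∫ t, (bump d n).normed volume (x - t) • f t := by
  rw [mollify, convolution_eq_swap]
  rfl

theorem contDiff_mollify (n : ℕ) {f : Space d → F} (hf : LocallyIntegrable f volume) :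
    ContDiff ℝ 1 (mollify n f) :=
  (bump d n).hasCompactSupport_normed.contDiff_convolution_left (n := 1) _
    (bump d n).contDiff_normed hf

theorem ae_tendsto_mollify [CompleteSpace F] {f : Space d → F}
    (hf : LocallyIntegrable f volume) :
    ∀ᵐ x, Tendsto (fun n => mollify n f x) atTop (𝓝 (f x)) := by
  -- The Lebesgue differentiation argument needs `rOut / rIn` bounded along the sequence; here the
  -- ratio is exactly `2`.
  refine ContDiffBump.ae_convolution_tendsto_right_of_locallyIntegrable (K := 2)
    (tendsto_bump_rOut d) (Eventually.of_forall fun n => le_of_eq ?_) hf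
  simp only [bump]
  field_simp

/-- The weak derivative is tested against `t ↦ ρ(x - t)`; the sign from reflecting `ρ` cancels the
sign from integrating by parts. -/
theorem fderiv_mollify {j : Fin d} {f g : Space d → F}
    (h : HasWeakPartialDeriv j f g) (n : ℕ) (x : Space d) :
    fderiv ℝ (mollify n f) x (EuclideanSpace.single j 1) = mollify n g x := by
  have hs : ContDiff ℝ ∞ ((bump d n).normed (volume : Measure (Space d))) :=
    (bump d n).contDiff_normed
  have hc := (bump d n).hasCompactSupport_normed (μ := (volume : Measure (Space d)))
  have h1 := (hc.hasFDerivAt_convolution_left (ContinuousLinearMap.lsmul ℝ ℝ)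
    (hs.of_le (by simp)) h.1 x).fderiv
  have hex := (hc.fderiv ℝ).convolutionExists_left
    (ContinuousLinearMap.precompL (Space d) (ContinuousLinearMap.lsmul ℝ ℝ : ℝ →L[ℝ] F →L[ℝ] F))
    (hs.continuous_fderiv (by simp)) h.1 x
  have hsub : ContDiff ℝ ∞ fun t => (bump d n).normed volume (x - t) :=
    hs.comp (contDiff_const.sub contDiff_id)
  have hsubc : HasCompactSupport fun t => (bump d n).normed volume (x - t) :=
    hc.comp_homeomorph (Homeomorph.subLeft x)
  have h2 := h.3 _ hsub hsubc
  rw [mollify, h1, mollify_apply, ← neg_eq_iff_eq_neg.2 h2, convolution_eq_swap,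
    ContinuousLinearMap.integral_apply hex.integrable_swap, ← integral_neg]
  refine integral_congr_ae (Eventually.of_forall fun t => ?_)
  have h3 : fderiv ℝ (fun t => (bump d n).normed volume (x - t)) t =
      -fderiv ℝ ((bump d n).normed volume) (x - t) := by
    have h4 := ((hs.differentiable (by simp) (x - t)).hasFDerivAt.comp t
      ((hasFDerivAt_id t).const_sub x)).fderiv
    rw [Function.comp_def] at h4
    simpa using h4
  simp [h3, ContinuousLinearMap.precompL_apply]

/-- `ρ(x - t) dt` is a probability measure, and averages stay in closed convex sets. The chain rule
below can therefore assume derivative bounds on such a set only. -/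
theorem mollify_mem [CompleteSpace F] (n : ℕ) {f : Space d → F}
    (hf : LocallyIntegrable f volume) {C : Set F} (hC : Convex ℝ C) (hC' : IsClosed C)
    (hfC : ∀ x, f x ∈ C) (x : Space d) : mollify n f x ∈ C := by
  set ρ := (bump d n).normed (volume : Measure (Space d)) with hρ
  have hm : Continuous fun t => ρ (x - t) :=
    (bump d n).continuous_normed.comp (continuous_const.sub continuous_id)
  have hnn : ∀ t, 0 ≤ ρ (x - t) := fun t => (bump d n).nonneg_normed _
  have hi : Integrable (fun t => ρ (x - t) • f t) volume :=
    integrable_test hf hm ((bump d n).hasCompactSupport_normed.comp_homeomorph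
      (Homeomorph.subLeft x))
  have hρi : Integrable (fun t => ρ (x - t)) volume :=
    (bump d n).integrable_normed.comp_sub_left x
  set μ : Measure (Space d) :=
    volume.withDensity fun t => ((ρ (x - t)).toNNReal : ℝ≥0∞) with hμ
  have hmm : Measurable fun t => (ρ (x - t)).toNNReal := hm.measurable.real_toNNReal
  have hprob : IsProbabilityMeasure μ := by
    constructor
    rw [hμ, withDensity_apply _ MeasurableSet.univ, Measure.restrict_univ]
    have : ∫⁻ t, ENNReal.ofReal (ρ (x - t)) = ENNReal.ofReal (∫ t, ρ (x - t)) :=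
      (ofReal_integral_eq_lintegral_ofReal hρi (Eventually.of_forall hnn)).symm
    rw [integral_sub_left_eq_self (μ := volume) ρ x, (bump d n).integral_normed] at this
    simpa [ENNReal.ofReal] using this
  have e : ∀ t, (ρ (x - t)).toNNReal • f t = ρ (x - t) • f t := fun t => by
    rw [NNReal.smul_def, Real.coe_toNNReal _ (hnn t)]
  have := hC.integral_mem (μ := μ) hC' (Eventually.of_forall hfC)
    (by rw [hμ, integrable_withDensity_iff_integrable_smul hmm]; simpa only [e] using hi)
  rw [hμ, integral_withDensity_eq_integral_smul hmm] at this
  rw [mollify_apply]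
  simpa only [e] using this

theorem lintegral_mollify_le [CompleteSpace F] (n : ℕ) {f : Space d → F}
    (hf : Integrable f volume) : ∫⁻ x, ‖mollify n f x‖ₑ ≤ ∫⁻ x, ‖f x‖ₑ := by
  have hρi := (bump d n).integrable_normed (μ := (volume : Measure (Space d)))
  have hle : ∀ x, ‖mollify n f x‖ ≤ mollify n (fun t => ‖f t‖) x := fun x => by
    rw [mollify_apply, mollify_apply]
    refine (norm_integral_le_integral_norm _).trans_eq (integral_congr_ae ?_)
    refine Eventually.of_forall fun t => ?_
    simp [norm_smul, abs_of_nonneg ((bump d n).nonneg_normed _)]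
  have hi : Integrable (mollify n fun t => ‖f t‖) volume :=
    hρi.integrable_convolution _ hf.norm
  have hI : ∫ x, mollify n (fun t => ‖f t‖) x = ∫ x, ‖f x‖ := by
    rw [mollify, integral_convolution _ hρi hf.norm, (bump d n).integral_normed]
    simp
  rw [← ofReal_integral_norm_eq_lintegral_enorm hf, ← hI,
    ofReal_integral_eq_lintegral_ofReal hi
      (Eventually.of_forall fun x => (norm_nonneg _).trans (hle x))]
  exact lintegral_mono fun x => by
    rw [← ofReal_norm]; exact ENNReal.ofReal_le_ofReal (hle x)

/-- Convergence in `L¹` on all balls. -/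
def L1LocTendsto (h : ℕ → Space d → F) (k : Space d → F) : Prop :=
  ∀ R : ℝ, Tendsto (fun n => ∫⁻ x in Metric.ball 0 R, ‖h n x - k x‖ₑ) atTop (𝓝 0)

/-- A Scheffé type argument. Fatou is applied to `‖f_n‖ + ‖f‖ - ‖f_n - f‖ ≥ 0`, which tends to
`2‖f‖` almost everywhere, while `L¹` contractivity of mollification bounds `∫ (‖f_n‖ + ‖f‖)` by `2 ∫
‖f‖`. -/
theorem tendsto_lintegral_mollify_sub [CompleteSpace F] {f : Space d → F}
    (hf : Integrable f volume) :
    Tendsto (fun n => ∫⁻ x, ‖mollify n f x - f x‖ₑ) atTop (𝓝 0) := by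
  have hm : ∀ n, AEStronglyMeasurable (mollify n f) volume := fun n =>
    (contDiff_mollify n hf.locallyIntegrable).continuous.aestronglyMeasurable
  set a := ∫⁻ x, ‖f x‖ₑ with ha
  have ha' : a ≠ ⊤ := hf.2.ne
  let Φ : ℕ → Space d → ℝ≥0∞ := fun n x => ‖mollify n f x‖ₑ + ‖f x‖ₑ - ‖mollify n f x - f x‖ₑ
  have hsum : ∀ n, (∫⁻ x, Φ n x) + ∫⁻ x, ‖mollify n f x - f x‖ₑ ≤ 2 * a := fun n => by
    have hme : AEMeasurable (fun x => ‖mollify n f x - f x‖ₑ) volume := ((hm n).sub hf.1).enorm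
    rw [← lintegral_add_right' _ hme]
    calc _ = ∫⁻ x, (‖mollify n f x‖ₑ + ‖f x‖ₑ) :=
          lintegral_congr fun x => tsub_add_cancel_of_le (enorm_sub_le)
      _ = (∫⁻ x, ‖mollify n f x‖ₑ) + a := lintegral_add_right' _ hf.1.enorm
      _ ≤ 2 * a := by rw [two_mul]; gcongr; exact lintegral_mollify_le n hf
  have hlim : 2 * a ≤ liminf (fun n => ∫⁻ x, Φ n x) atTop := by
    refine le_trans (le_of_eq ?_) (lintegral_liminf_le' fun n =>
      ((hm n).enorm.add hf.1.enorm).sub ((hm n).sub hf.1).enorm)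
    rw [ha, ← lintegral_const_mul' _ _ (by simp)]
    refine lintegral_congr_ae ?_
    filter_upwards [ae_tendsto_mollify hf.locallyIntegrable] with x hx
    have h1 : Tendsto (fun n => Φ n x) atTop (𝓝 (‖f x‖ₑ + ‖f x‖ₑ - ‖f x - f x‖ₑ)) :=
      ENNReal.Tendsto.sub (hx.enorm.add tendsto_const_nhds) (hx.sub tendsto_const_nhds).enorm
        (Or.inr (by simp))
    rw [h1.liminf_eq]
    simp [two_mul]
  rw [ENNReal.tendsto_nhds_zero]
  intro ε hε
  -- For `a = 0` the strict inequality `2a - ε < 2a` fails, so this case is separate.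
  by_cases ha0 : a = 0
  · refine Eventually.of_forall fun n => ?_
    have := (le_add_self (a := ∫⁻ x, ‖mollify n f x - f x‖ₑ)).trans (hsum n)
    rw [ha0, mul_zero] at this
    exact this.trans zero_le
  · have h2a : 2 * a ≠ ⊤ := ENNReal.mul_ne_top (by simp) ha'
    have hlt : 2 * a - ε < liminf (fun n => ∫⁻ x, Φ n x) atTop :=
      (ENNReal.sub_lt_self h2a (by simpa using ha0) hε.ne').trans_le hlim
    filter_upwards [eventually_lt_of_lt_liminf hlt] with n hn
    have h3 := hsum n
    have hfin : ∫⁻ x, Φ n x ≠ ⊤ := ne_top_of_le_ne_top h2a (le_self_add.trans h3)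
    have h4 : ∫⁻ x, ‖mollify n f x - f x‖ₑ ≤ 2 * a - ∫⁻ x, Φ n x :=
      ENNReal.le_sub_of_add_le_left hfin h3
    refine h4.trans ?_
    rw [tsub_le_iff_left]
    exact tsub_le_iff_right.1 hn.le

/-- All bumps have radius at most `1`, so on the ball of radius `R` mollification sees only the
values on the ball of radius `R + 1`; cutting off there reduces to the integrable case. -/
theorem l1LocTendsto_mollify [CompleteSpace F] {f : Space d → F}
    (hf : LocallyIntegrable f volume) : L1LocTendsto (fun n => mollify n f) f := by
  intro R
  set B := Metric.ball (0 : Space d) (R + 1) with hB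
  have hi : Integrable (B.indicator f) volume :=
    (integrable_indicator_iff Metric.isOpen_ball.measurableSet).2
      ((hf.integrableOn_isCompact (isCompact_closedBall 0 (R + 1))).mono_set
        Metric.ball_subset_closedBall)
  refine tendsto_of_tendsto_of_tendsto_of_le_of_le tendsto_const_nhds
    (tendsto_lintegral_mollify_sub hi) (fun _ => zero_le) fun n => ?_
  refine le_trans ?_ (setLIntegral_le_lintegral (Metric.ball 0 R) _)
  refine setLIntegral_mono' Metric.isOpen_ball.measurableSet fun x hx => le_of_eq ?_
  rw [mem_ball_zero_iff] at hx
  have hxB : x ∈ B := by rw [hB, mem_ball_zero_iff]; linarith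
  have : mollify n f x = mollify n (B.indicator f) x := by
    rw [mollify_apply, mollify_apply]
    refine integral_congr_ae (Eventually.of_forall fun t => ?_)
    by_cases ht : t ∈ B
    · simp [ht]
    · have h0 : (bump d n).normed (volume : Measure (Space d)) (x - t) = 0 := by
        rw [← Function.notMem_support, ContDiffBump.support_normed_eq, mem_ball_zero_iff, not_lt]
        rw [hB, mem_ball_zero_iff, not_lt] at ht
        have h1 : (bump d n).rOut ≤ 1 := by
          simp only [bump]
          rw [div_le_one (by positivity)]
          linarith [(n.cast_nonneg : (0 : ℝ) ≤ n)]
        have := norm_sub_norm_le t x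
        rw [norm_sub_rev] at this
        linarith
      simp [h0]
  simp only
  rw [this, Set.indicator_of_mem hxB]

theorem L1LocTendsto.tendsto_integral_smul {h : ℕ → Space d → F} {k : Space d → F}
    (hk : L1LocTendsto h k) (hh : ∀ n, LocallyIntegrable (h n) volume)
    (hki : LocallyIntegrable k volume) {φ : Space d → ℝ} (hφ : Continuous φ)
    (hφc : HasCompactSupport φ) :
    Tendsto (fun n => ∫ x, φ x • h n x) atTop (𝓝 (∫ x, φ x • k x)) := by
  refine tendsto_integral_of_L1 _ (integrable_test hki hφ hφc).1
    (Eventually.of_forall fun n => integrable_test (hh n) hφ hφc) ?_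
  obtain ⟨C, hC⟩ := hφc.exists_bound_of_continuous hφ
  obtain ⟨R, hR⟩ := hφc.isBounded.subset_ball (0 : Space d)
  have h1 : Tendsto (fun n => ENNReal.ofReal C * ∫⁻ x in Metric.ball 0 R, ‖h n x - k x‖ₑ) atTop
      (𝓝 (ENNReal.ofReal C * 0)) := ENNReal.Tendsto.const_mul (hk R) (Or.inr (by simp))
  rw [mul_zero] at h1
  refine tendsto_of_tendsto_of_tendsto_of_le_of_le tendsto_const_nhds h1 (fun _ => zero_le)
    fun n => ?_
  rw [← lintegral_const_mul' _ _ (by simp), ← lintegral_indicator Metric.isOpen_ball.measurableSet]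
  refine lintegral_mono fun x => ?_
  rw [← smul_sub, enorm_smul]
  by_cases hx : x ∈ Metric.ball (0 : Space d) R
  · rw [Set.indicator_of_mem hx]
    gcongr
    rw [← ofReal_norm]
    exact ENNReal.ofReal_le_ofReal (hC x)
  · have : φ x = 0 := image_eq_zero_of_notMem_tsupport fun h => hx (hR h)
    simp [this]

end Mollifier

/-! ### The chain rule for weak derivatives. -/

section ChainRule

theorem locallyIntegrable_norm {d : ℕ} {E : Type*} [NormedAddCommGroup E] {f : Space d → E}
    (hf : LocallyIntegrable f volume) : LocallyIntegrable (fun x => ‖f x‖) volume :=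
  fun x => (hf x).norm

variable {d : ℕ} {E F : Type*} [NormedAddCommGroup E] [NormedSpace ℝ E]
  [NormedAddCommGroup F] [NormedSpace ℝ F] {j : Fin d}

/-- A `C¹` function has its classical partial derivatives as weak partial derivatives. -/
theorem hasWeakPartialDeriv_of_contDiff {f : Space d → F} (hf : ContDiff ℝ 1 f) (j : Fin d) :
    HasWeakPartialDeriv j f fun x => fderiv ℝ f x (EuclideanSpace.single j 1) := by
  have hc : Continuous fun x => fderiv ℝ f x (EuclideanSpace.single j 1) :=
    (hf.continuous_fderiv one_ne_zero).clm_apply continuous_const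
  refine ⟨hf.continuous.locallyIntegrable, hc.locallyIntegrable, fun φ hφ hφc => ?_⟩
  rw [integral_smul_fderiv_eq_neg_fderiv_smul_of_integrable, neg_neg]
  · exact ((continuous_partial hφ j).smul hf.continuous).integrable_of_hasCompactSupport
      (hasCompactSupport_partial hφc j).smul_right
  · exact (hφ.continuous.smul hc).integrable_of_hasCompactSupport hφc.smul_right
  · exact (hφ.continuous.smul hf.continuous).integrable_of_hasCompactSupport hφc.smul_right
  · exact fun x _ => hφ.differentiable (by simp) x
  · exact fun x _ => hf.differentiable one_ne_zero x

/-- The chain rule for weak derivatives. -/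
theorem HasWeakPartialDeriv.comp [CompleteSpace E] [SecondCountableTopology E]
    [SecondCountableTopology F] [MeasurableSpace E] [BorelSpace E] {f g : Space d → E}
    (h : HasWeakPartialDeriv j f g) {T : E → F} (hT : ContDiff ℝ 1 T) {C : Set E}
    (hC : Convex ℝ C) (hC' : IsClosed C) (hfC : ∀ x, f x ∈ C) {K : ℝ}
    (hK : ∀ z ∈ C, ‖fderiv ℝ T z‖ ≤ K) :
    HasWeakPartialDeriv j (fun x => T (f x)) (fun x => fderiv ℝ T (f x) (g x)) := by
  have hK0 : 0 ≤ K := (norm_nonneg _).trans (hK _ (hfC 0))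
  -- Convexity turns the derivative bound into a Lipschitz bound on `C`. The products with a phase
  -- or a cut-off treated later have bounded derivative only on a slab, hence the set `C`.
  have hlip : ∀ z ∈ C, ∀ w ∈ C, ‖T z - T w‖ ≤ K * ‖z - w‖ := fun z hz w hw =>
    hC.norm_image_sub_le_of_norm_fderiv_le (fun y _ => hT.differentiable one_ne_zero y) hK hw hz
  have hDc : Continuous (fderiv ℝ T) := hT.continuous_fderiv one_ne_zero
  have hDm : ∀ {u v : Space d → E}, AEStronglyMeasurable u volume →
      AEStronglyMeasurable v volume →
      AEStronglyMeasurable (fun x => fderiv ℝ T (u x) (v x)) volume := fun hu hv =>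
    (isBoundedBilinearMap_apply (𝕜 := ℝ) (E := E) (F := F)).continuous.comp_aestronglyMeasurable
      ((hDc.comp_aestronglyMeasurable hu).prodMk hv)
  have hfm := h.1.aestronglyMeasurable
  have hgm := h.2.aestronglyMeasurable
  have i1 : LocallyIntegrable (fun x => T (f x)) volume := by
    have : LocallyIntegrable (fun x => K * ‖f x - f 0‖ + ‖T (f 0)‖) volume :=
      ((locallyIntegrable_norm (h.1.sub (locallyIntegrable_const (f 0)))).smul K).add (locallyIntegrable_const _)
    refine this.mono (hT.continuous.comp_aestronglyMeasurable hfm)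
      (Eventually.of_forall fun x => ?_)
    rw [Real.norm_of_nonneg (by positivity)]
    have := hlip _ (hfC x) _ (hfC 0)
    have := norm_le_norm_sub_add (T (f x)) (T (f 0))
    linarith
  have i2 : LocallyIntegrable (fun x => fderiv ℝ T (f x) (g x)) volume := by
    refine ((locallyIntegrable_norm h.2).smul K).mono (hDm hfm hgm) (Eventually.of_forall fun x => ?_)
    rw [Pi.smul_apply, smul_eq_mul, Real.norm_of_nonneg (by positivity)]
    exact (fderiv ℝ T (f x)).le_of_opNorm_le (hK _ (hfC x)) _
  refine ⟨i1, i2, fun φ hφ hφc => ?_⟩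
  have hfn : ∀ n, ContDiff ℝ 1 (mollify n f) := fun n => contDiff_mollify n h.1
  have hmem : ∀ n x, mollify n f x ∈ C := fun n => mollify_mem n h.1 hC hC' hfC
  have hw : ∀ n, HasWeakPartialDeriv j (fun x => T (mollify n f x))
      (fun x => fderiv ℝ T (mollify n f x) (mollify n g x)) := fun n => by
    have h1 := hasWeakPartialDeriv_of_contDiff (hT.comp (hfn n)) j
    refine h1.congr_ae EventuallyEq.rfl (Eventually.of_forall fun x => ?_)
    simp only
    rw [fderiv_comp x (hT.differentiable one_ne_zero _) ((hfn n).differentiable one_ne_zero _),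
      ContinuousLinearMap.comp_apply, fderiv_mollify h]
  have c1 : L1LocTendsto (fun n x => T (mollify n f x)) (fun x => T (f x)) := fun R => by
    have h1 := ENNReal.Tendsto.const_mul (a := ENNReal.ofReal K) (l1LocTendsto_mollify h.1 R)
      (Or.inr (by simp))
    rw [mul_zero] at h1
    refine tendsto_of_tendsto_of_tendsto_of_le_of_le tendsto_const_nhds h1 (fun _ => zero_le)
      fun n => ?_
    rw [← lintegral_const_mul' _ _ (by simp)]
    refine lintegral_mono fun x => ?_
    rw [← ofReal_norm, ← ofReal_norm, ← ENNReal.ofReal_mul hK0]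
    exact ENNReal.ofReal_le_ofReal (hlip _ (hmem n x) _ (hfC x))
  have c2 : L1LocTendsto (fun n x => fderiv ℝ T (mollify n f x) (mollify n g x))
      (fun x => fderiv ℝ T (f x) (g x)) := fun R => by
    have h1 := ENNReal.Tendsto.const_mul (a := ENNReal.ofReal K) (l1LocTendsto_mollify h.2 R)
      (Or.inr (by simp))
    -- The difference of derivatives splits in two. One part has the bounded factor `DT(f_n)` acting
    -- on `g_n - g`; in this one `g` is fixed, `DT(f_n) → DT(f)` almost everywhere, and `2K ‖g‖`
    -- dominates.
    have h2 : Tendsto (fun n => ∫⁻ x in Metric.ball 0 R,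
        ‖(fderiv ℝ T (mollify n f x) - fderiv ℝ T (f x)) (g x)‖ₑ) atTop (𝓝 (∫⁻ _ in
          Metric.ball (0 : Space d) R, 0)) := by
      have hgi : IntegrableOn g (Metric.ball 0 R) volume :=
        (h.2.integrableOn_isCompact (isCompact_closedBall 0 R)).mono_set
          Metric.ball_subset_closedBall
      refine tendsto_lintegral_of_dominated_convergence' (fun x => ENNReal.ofReal (K + K) * ‖g x‖ₑ)
        (fun n => ?_) (fun n => Eventually.of_forall fun x => ?_) ?_ ?_
      · simp only [sub_apply]
        exact ((hDm (hfn n).continuous.aestronglyMeasurable hgm).sub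
          (hDm hfm hgm)).restrict.enorm
      · simp only
        rw [← ofReal_norm, ← ofReal_norm, ← ENNReal.ofReal_mul (by positivity)]
        refine ENNReal.ofReal_le_ofReal (ContinuousLinearMap.le_of_opNorm_le _ ?_ _)
        exact (norm_sub_le _ _).trans (add_le_add (hK _ (hmem n x)) (hK _ (hfC x)))
      · rw [lintegral_const_mul' _ _ (by simp)]
        exact ENNReal.mul_ne_top (by simp) hgi.2.ne
      · filter_upwards [ae_restrict_of_ae (ae_tendsto_mollify h.1)] with x hx
        have h3 : Tendsto (fun n => (fderiv ℝ T (mollify n f x) - fderiv ℝ T (f x)) (g x)) atTop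
            (𝓝 ((fderiv ℝ T (f x) - fderiv ℝ T (f x)) (g x))) :=
          by
          have h4 : Continuous fun z => (fderiv ℝ T z - fderiv ℝ T (f x)) (g x) :=
            (hDc.sub continuous_const).clm_apply continuous_const
          exact (h4.tendsto _).comp hx
        simpa using h3.enorm
    rw [mul_zero] at h1
    rw [lintegral_zero] at h2
    have h12 := h1.add h2
    rw [add_zero] at h12
    refine tendsto_of_tendsto_of_tendsto_of_le_of_le tendsto_const_nhds h12 (fun _ => zero_le)
      fun n => ?_
    have hmn := (contDiff_mollify n h.2).continuous.aestronglyMeasurable (μ := volume)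
    rw [← lintegral_const_mul' _ _ (by simp), ← lintegral_add_left']
    · refine lintegral_mono fun x => ?_
      have : fderiv ℝ T (mollify n f x) (mollify n g x) - fderiv ℝ T (f x) (g x) =
          fderiv ℝ T (mollify n f x) (mollify n g x - g x) +
          (fderiv ℝ T (mollify n f x) - fderiv ℝ T (f x)) (g x) := by
        simp
      simp only
      rw [this]
      refine (enorm_add_le _ _).trans (add_le_add_left ?_ _)
      rw [← ofReal_norm, ← ofReal_norm, ← ENNReal.ofReal_mul hK0]
      exact ENNReal.ofReal_le_ofReal (ContinuousLinearMap.le_of_opNorm_le _ (hK _ (hmem n x)) _)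
    · exact ((hmn.sub hgm).enorm.const_mul _).restrict
  have t1 := c1.tendsto_integral_smul (fun n => (hw n).1) i1 (continuous_partial hφ j)
    (hasCompactSupport_partial hφc j)
  have t2 := c2.tendsto_integral_smul (fun n => (hw n).2) i2 hφ.continuous hφc
  refine tendsto_nhds_unique t1 (t2.neg.congr fun n => ((hw n).3 φ hφ hφc).symm)

end ChainRule

/-! ### Product and scaling rules for weak derivatives. -/

section WeakDerivativeRules

variable {d : ℕ} {E F : Type*} [NormedAddCommGroup E] [NormedSpace ℝ E]
  [NormedAddCommGroup F] [NormedSpace ℝ F] {j : Fin d}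

theorem HasWeakPartialDeriv.prodMk [CompleteSpace E] [CompleteSpace F] {f f' : Space d → E}
    {g g' : Space d → F} (hf : HasWeakPartialDeriv j f f') (hg : HasWeakPartialDeriv j g g') :
    HasWeakPartialDeriv j (fun x => (f x, g x)) (fun x => (f' x, g' x)) := by
  have hi : ∀ {u : Space d → E} {v : Space d → F}, LocallyIntegrable u volume →
      LocallyIntegrable v volume → LocallyIntegrable (fun x => (u x, v x)) volume :=
    fun hu hv => (locallyIntegrable_norm hu).add (locallyIntegrable_norm hv) |>.mono
      (hu.aestronglyMeasurable.prodMk hv.aestronglyMeasurable) (Eventually.of_forall fun x => by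
        simp only [Prod.norm_mk, Pi.add_apply]
        rw [Real.norm_of_nonneg (by positivity)]
        exact max_le_add_of_nonneg (norm_nonneg _) (norm_nonneg _))
  refine ⟨hi hf.1 hg.1, hi hf.2 hg.2, fun φ hφ hφc => ?_⟩
  have c1 := continuous_partial hφ j
  have c2 := hasCompactSupport_partial hφc j
  simp only [Prod.smul_mk]
  rw [integral_pair (integrable_test hf.1 c1 c2) (integrable_test hg.1 c1 c2),
    integral_pair (integrable_test hf.2 hφ.continuous hφc)
      (integrable_test hg.2 hφ.continuous hφc), hf.3 φ hφ hφc, hg.3 φ hφ hφc]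
  rfl

theorem locallyIntegrable_smul_continuous {f : Space d → F} (hf : LocallyIntegrable f volume)
    {η : Space d → ℝ} (hη : Continuous η) : LocallyIntegrable (fun x => η x • f x) volume := by
  rw [locallyIntegrable_iff]
  intro K hK
  exact (hf.integrableOn_isCompact hK).continuousOn_smul hη.continuousOn hK

theorem HasWeakPartialDeriv.smooth_smul {f g : Space d → F} (h : HasWeakPartialDeriv j f g)
    {η : Space d → ℝ} (hη : ContDiff ℝ ∞ η) :
    HasWeakPartialDeriv j (fun x => η x • f x)
      (fun x => fderiv ℝ η x (EuclideanSpace.single j 1) • f x + η x • g x) := by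
  have cη := continuous_partial hη j
  refine ⟨locallyIntegrable_smul_continuous h.1 hη.continuous,
    (locallyIntegrable_smul_continuous h.1 cη).add
      (locallyIntegrable_smul_continuous h.2 hη.continuous), fun φ hφ hφc => ?_⟩
  have h1 := h.3 (fun x => φ x * η x) (hφ.mul hη) hφc.mul_right
  have e : ∀ x, fderiv ℝ (fun x => φ x * η x) x (EuclideanSpace.single j 1) • f x =
      fderiv ℝ φ x (EuclideanSpace.single j 1) • η x • f x +
      φ x • fderiv ℝ η x (EuclideanSpace.single j 1) • f x := fun x => by
    rw [fderiv_fun_mul (hφ.differentiable (by simp) x) (hη.differentiable (by simp) x)]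
    simp only [add_apply, smul_apply, smul_eq_mul, smul_smul, ← add_smul]
    congr 1
    ring
  have i1 : Integrable (fun x => fderiv ℝ φ x (EuclideanSpace.single j 1) • η x • f x) volume :=
    integrable_test (locallyIntegrable_smul_continuous h.1 hη.continuous)
      (continuous_partial hφ j) (hasCompactSupport_partial hφc j)
  have i2 : Integrable
      (fun x => φ x • fderiv ℝ η x (EuclideanSpace.single j 1) • f x) volume :=
    integrable_test (locallyIntegrable_smul_continuous h.1 cη) hφ.continuous hφc
  have i3 : Integrable (fun x => φ x • η x • g x) volume :=
    integrable_test (locallyIntegrable_smul_continuous h.2 hη.continuous) hφ.continuous hφc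
  simp only [e, mul_smul] at h1
  rw [integral_add i1 i2] at h1
  simp only [smul_add]
  rw [integral_add i2 i3, neg_add, ← h1]
  abel

theorem HasWeakPartialDeriv.sum {ι : Type*} (s : Finset ι) {f g : ι → Space d → F}
    (h : ∀ i ∈ s, HasWeakPartialDeriv j (f i) (g i)) :
    HasWeakPartialDeriv j (fun x => ∑ i ∈ s, f i x) (fun x => ∑ i ∈ s, g i x) := by
  classical
  induction s using Finset.induction_on with
  | empty =>
    simp only [Finset.sum_empty]
    exact ⟨locallyIntegrable_const 0, locallyIntegrable_const 0, by simp⟩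
  | insert i s hi ih =>
    simp only [Finset.sum_insert hi]
    exact (h i (by simp)).add (ih fun k hk => h k (by simp [hk]))

theorem lintegral_comp_smul_space {r : ℝ} (hr : 0 < r) (f : Space d → ℝ≥0∞) :
    ∫⁻ x, f (r • x) = ENNReal.ofReal ((r ^ d)⁻¹) * ∫⁻ x, f x := by
  have h1 := Measure.map_addHaar_smul (volume : Measure (Space d)) hr.ne'
  have h2 := lintegral_map_equiv (μ := volume) f
    (Homeomorph.smulOfNeZero r hr.ne' : Space d ≃ₜ Space d).toMeasurableEquiv
  have h3 : (⇑(Homeomorph.smulOfNeZero r hr.ne' : Space d ≃ₜ Space d).toMeasurableEquiv) =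
      fun x => r • x := rfl
  rw [h3] at h2
  rw [← h2, h1, lintegral_smul_measure, finrank_euclideanSpace_fin, abs_of_pos (by positivity),
    smul_eq_mul]

theorem quasiMeasurePreserving_smul {r : ℝ} (hr : r ≠ 0) :
    Measure.QuasiMeasurePreserving (fun x : Space d => r • x) volume volume := by
  refine ⟨measurable_const_smul r, ?_⟩
  rw [Measure.map_addHaar_smul _ hr]
  exact Measure.smul_absolutelyContinuous

theorem locallyIntegrable_comp_smul {F : Type*} [NormedAddCommGroup F] {f : Space d → F} (hf : LocallyIntegrable f volume) {r : ℝ}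
    (hr : r ≠ 0) : LocallyIntegrable (fun x => f (r • x)) volume := by
  rw [locallyIntegrable_iff]
  intro K hK
  have hK' : IsCompact ((fun x : Space d => r • x) '' K) := hK.image (continuous_const_smul r)
  have h1 : Integrable (((fun x : Space d => r • x) '' K).indicator f) volume :=
    (integrable_indicator_iff hK'.measurableSet).2 (hf.integrableOn_isCompact hK')
  refine (h1.comp_smul hr).integrableOn.congr_fun (fun x hx => ?_) hK.measurableSet
  simp only
  rw [Set.indicator_of_mem (Set.mem_image_of_mem _ hx)]

theorem HasWeakPartialDeriv.comp_smul {f g : Space d → F} (h : HasWeakPartialDeriv j f g) {r : ℝ}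
    (hr : r ≠ 0) : HasWeakPartialDeriv j (fun x => f (r • x)) (fun x => r • g (r • x)) := by
  refine ⟨locallyIntegrable_comp_smul h.1 hr, (locallyIntegrable_comp_smul h.2 hr).smul r,
    fun φ hφ hφc => ?_⟩
  have hs : ContDiff ℝ ∞ fun x => φ (r⁻¹ • x) := hφ.comp (contDiff_const_smul _)
  have hsc : HasCompactSupport fun x => φ (r⁻¹ • x) :=
    hφc.comp_homeomorph (Homeomorph.smulOfNeZero r⁻¹ (inv_ne_zero hr))
  have h1 := h.3 _ hs hsc
  have h2 : ∀ y, fderiv ℝ (fun x => φ (r⁻¹ • x)) y (EuclideanSpace.single j 1) =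
      r⁻¹ * fderiv ℝ φ (r⁻¹ • y) (EuclideanSpace.single j 1) := fun y => by
    rw [fderiv_comp_smul]; rfl
  have e1 := Measure.integral_comp_smul volume
    (fun y => fderiv ℝ φ (r⁻¹ • y) (EuclideanSpace.single j 1) • f y) r
  have e2 := Measure.integral_comp_smul volume (fun y => φ (r⁻¹ • y) • g y) r
  simp only [smul_smul, inv_mul_cancel₀ hr, one_smul] at e1 e2
  simp only [h2, mul_smul, integral_smul] at h1
  rw [e1]
  simp only [smul_comm _ r, integral_smul]
  rw [e2, smul_comm r, ← smul_neg, ← smul_neg, ← h1, smul_smul r, mul_inv_cancel₀ hr, one_smul]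

theorem contDiff_coord (j : Fin d) : ContDiff ℝ ∞ fun x : Space d => x j :=
  (EuclideanSpace.proj (𝕜 := ℝ) j).contDiff

theorem fderiv_coord (j k : Fin d) (x : Space d) :
    fderiv ℝ (fun x : Space d => x j) x (EuclideanSpace.single k 1) = if j = k then 1 else 0 := by
  have : fderiv ℝ (fun x : Space d => x j) x = EuclideanSpace.proj (𝕜 := ℝ) j :=
    (EuclideanSpace.proj (𝕜 := ℝ) j).fderiv
  rw [this]
  simp

end WeakDerivativeRules

/-! ### Integration along rays through the origin. -/

section RayIntegral

variable {d : ℕ}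

/-- The weighted integral of `h` along the ray from `x` to `r x`. -/
def rayInt (w : ℝ → ℝ) (r : ℝ) (h : Space d → ℝ) (x : Space d) : ℝ :=
  ∫ ρ in (1 : ℝ)..r, w ρ * h (ρ • x)

theorem mem_uIoc_one {r ρ : ℝ} (hρ : ρ ∈ Set.uIoc 1 r) : min 1 r ≤ ρ ∧ ρ ≤ max 1 r :=
  ⟨hρ.1.le, hρ.2⟩

theorem pos_of_mem_uIoc_one {r ρ : ℝ} (hr : 0 < r) (hρ : ρ ∈ Set.uIoc 1 r) : 0 < ρ :=
  (lt_min one_pos hr).trans_le (mem_uIoc_one hρ).1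

/-- The image ball has radius `ρ R ≤ max 1 r * R` and the Jacobian is `ρ^(-d) ≤ (min 1 r)^(-d)`, so
the bound is uniform in `ρ` and can be integrated over the ray. -/
theorem lintegral_ball_comp_smul_le {r : ℝ} (hr : 0 < r) {ρ : ℝ} (hρ : ρ ∈ Set.uIoc 1 r) {R : ℝ}
    (hR : 0 ≤ R) (h : Space d → ℝ≥0∞) :
    ∫⁻ x in Metric.ball 0 R, h (ρ • x) ≤
      ENNReal.ofReal ((min 1 r ^ d)⁻¹) * ∫⁻ x in Metric.ball 0 (max 1 r * R), h x := by
  have hρ0 := pos_of_mem_uIoc_one hr hρ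
  obtain ⟨h1, h2⟩ := mem_uIoc_one hρ
  have hm : 0 < min 1 r := lt_min one_pos hr
  have e : ∀ x : Space d, (Metric.ball 0 R).indicator (fun x => h (ρ • x)) x =
      (Metric.ball 0 (ρ * R)).indicator h (ρ • x) := fun x => by
    have : x ∈ Metric.ball (0 : Space d) R ↔ ρ • x ∈ Metric.ball (0 : Space d) (ρ * R) := by
      rw [mem_ball_zero_iff, mem_ball_zero_iff, norm_smul, Real.norm_of_nonneg hρ0.le,
        mul_lt_mul_iff_right₀ hρ0]
    by_cases hx : x ∈ Metric.ball (0 : Space d) R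
    · rw [Set.indicator_of_mem hx, Set.indicator_of_mem (this.1 hx)]
    · rw [Set.indicator_of_notMem hx, Set.indicator_of_notMem (mt this.2 hx)]
  rw [← lintegral_indicator Metric.isOpen_ball.measurableSet]
  simp only [e]
  rw [lintegral_comp_smul_space hρ0, lintegral_indicator Metric.isOpen_ball.measurableSet]
  gcongr

theorem lintegral_ball_ray_le {r : ℝ} (hr : 0 < r) {R : ℝ} (hR : 0 ≤ R) (h : Space d → ℝ≥0∞) :
    ∫⁻ ρ in Set.uIoc 1 r, ∫⁻ x in Metric.ball 0 R, h (ρ • x) ≤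
      ENNReal.ofReal ((min 1 r ^ d)⁻¹) * (∫⁻ x in Metric.ball 0 (max 1 r * R), h x) *
        ENNReal.ofReal |r - 1| := by
  calc _ ≤ ∫⁻ _ in Set.uIoc 1 r,
        ENNReal.ofReal ((min 1 r ^ d)⁻¹) * ∫⁻ x in Metric.ball 0 (max 1 r * R), h x :=
        setLIntegral_mono' measurableSet_uIoc fun ρ hρ => lintegral_ball_comp_smul_le hr hρ hR h
    _ = _ := by rw [setLIntegral_const, Real.volume_uIoc]

/-- This licenses Fubini between the ray parameter and space. Honest measurability of `h`, rather
than almost everywhere measurability, makes `(ρ, x) ↦ h (ρ • x)` jointly measurable directly. -/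
theorem integrable_ray {r : ℝ} (hr : 0 < r) {w : ℝ → ℝ} (hw : Measurable w) {c : ℝ}
    (hwc : ∀ ρ ∈ Set.uIoc 1 r, |w ρ| ≤ c) {h : Space d → ℝ} (hm : Measurable h)
    (hh : LocallyIntegrable h volume) (R : ℝ) :
    Integrable (fun z : ℝ × Space d => w z.1 * h (z.1 • z.2))
      ((volume.restrict (Set.uIoc 1 r)).prod (volume.restrict (Metric.ball 0 R))) := by
  have hc : 0 ≤ |c| := abs_nonneg c
  have hmeas : Measurable fun z : ℝ × Space d => w z.1 * h (z.1 • z.2) := by fun_prop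
  refine ⟨hmeas.aestronglyMeasurable, ?_⟩
  rw [HasFiniteIntegral, lintegral_prod _ hmeas.enorm.aemeasurable]
  rcases le_or_gt R 0 with hR | hR
  · simp [Metric.ball_eq_empty.2 hR]
  have hint : ∫⁻ x in Metric.ball 0 (max 1 r * R), ‖h x‖ₑ < ⊤ :=
    ((hh.integrableOn_isCompact (isCompact_closedBall 0 (max 1 r * R))).mono_set
      Metric.ball_subset_closedBall).2
  calc _ ≤ ∫⁻ ρ in Set.uIoc 1 r, ENNReal.ofReal |c| * ∫⁻ x in Metric.ball 0 R, ‖h (ρ • x)‖ₑ := by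
        refine setLIntegral_mono' measurableSet_uIoc fun ρ hρ => ?_
        rw [← lintegral_const_mul' _ _ (by simp)]
        refine lintegral_mono fun x => ?_
        rw [enorm_mul]
        gcongr
        rw [← ofReal_norm]
        exact ENNReal.ofReal_le_ofReal ((hwc ρ hρ).trans (le_abs_self c))
    _ < ⊤ := by
        rw [lintegral_const_mul' _ _ (by simp)]
        refine (mul_le_mul_right (lintegral_ball_ray_le hr hR.le fun x => ‖h x‖ₑ) _).trans_lt ?_
        exact ENNReal.mul_lt_top ENNReal.ofReal_lt_top (ENNReal.mul_lt_top
          (ENNReal.mul_lt_top ENNReal.ofReal_lt_top hint) ENNReal.ofReal_lt_top)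

theorem ae_intervalIntegrable_ray {r : ℝ} (hr : 0 < r) {w : ℝ → ℝ} (hw : Measurable w) {c : ℝ}
    (hwc : ∀ ρ ∈ Set.uIoc 1 r, |w ρ| ≤ c) {h : Space d → ℝ} (hm : Measurable h)
    (hh : LocallyIntegrable h volume) :
    ∀ᵐ x : Space d, IntervalIntegrable (fun ρ => w ρ * h (ρ • x)) volume 1 r := by
  have key : ∀ n : ℕ, ∀ᵐ x : Space d, x ∈ Metric.ball (0 : Space d) n →
      IntervalIntegrable (fun ρ => w ρ * h (ρ • x)) volume 1 r := fun n => by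
    rw [← ae_restrict_iff' Metric.isOpen_ball.measurableSet]
    filter_upwards [(integrable_ray hr hw hwc hm hh n).prod_left_ae] with x hx
    exact intervalIntegrable_iff.2 hx
  filter_upwards [ae_all_iff.2 key] with x hx
  obtain ⟨n, hn⟩ := exists_nat_gt ‖x‖
  exact hx n (by simpa using hn)

theorem locallyIntegrable_rayInt {r : ℝ} (hr : 0 < r) {w : ℝ → ℝ} (hw : Measurable w) {c : ℝ}
    (hwc : ∀ ρ ∈ Set.uIoc 1 r, |w ρ| ≤ c) {h : Space d → ℝ} (hm : Measurable h)
    (hh : LocallyIntegrable h volume) : LocallyIntegrable (rayInt w r h) volume := by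
  rw [locallyIntegrable_iff]
  intro K hK
  obtain ⟨R, hR⟩ := hK.isBounded.subset_ball (0 : Space d)
  have h1 := ((integrable_ray hr hw hwc hm hh R).integral_prod_right).smul
    (if (1 : ℝ) ≤ r then (1 : ℝ) else -1)
  refine IntegrableOn.mono_set (t := Metric.ball 0 R) (h1.congr ?_) hR
  refine Eventually.of_forall fun x => ?_
  rw [rayInt, intervalIntegral.intervalIntegral_eq_integral_uIoc]
  rfl

theorem integral_mul_rayInt {r : ℝ} (hr : 0 < r) {w : ℝ → ℝ} (hw : Measurable w) {c : ℝ}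
    (hwc : ∀ ρ ∈ Set.uIoc 1 r, |w ρ| ≤ c) {h : Space d → ℝ} (hm : Measurable h)
    (hh : LocallyIntegrable h volume) {φ : Space d → ℝ} (hφ : Continuous φ)
    (hφc : HasCompactSupport φ) :
    ∫ x, φ x * rayInt w r h x = ∫ ρ in (1 : ℝ)..r, w ρ * ∫ x, φ x * h (ρ • x) := by
  obtain ⟨C, hC⟩ := hφc.exists_bound_of_continuous hφ
  obtain ⟨R, hR⟩ := hφc.isBounded.subset_ball (0 : Space d)
  have h0 : ∀ x ∉ Metric.ball (0 : Space d) R, φ x = 0 := fun x hx =>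
    image_eq_zero_of_notMem_tsupport fun h => hx (hR h)
  have hr1 : ∀ u : Space d → ℝ, ∫ x, φ x * u x = ∫ x in Metric.ball 0 R, φ x * u x := fun u =>
    (setIntegral_eq_integral_of_forall_compl_eq_zero fun x hx => by rw [h0 x hx, zero_mul]).symm
  simp only [hr1, ← integral_const_mul]
  rw [intervalIntegral_integral_swap]
  · simp only [rayInt, ← intervalIntegral.integral_const_mul]
    refine integral_congr_ae (Eventually.of_forall fun x => ?_)
    refine intervalIntegral.integral_congr fun ρ _ => ?_
    ring
  · have h1 := (integrable_ray hr hw hwc hm hh R).bdd_mul (c := C) (f := fun z => φ z.2)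
      (hφ.comp continuous_snd).aestronglyMeasurable (Eventually.of_forall fun z => hC z.2)
    refine h1.congr (Eventually.of_forall fun z => ?_)
    simp only [Function.uncurry]
    ring

/-- Differentiating `h(ρ x)` in `x` produces a factor `ρ`, which cancels the weight `ρ⁻¹`; Fubini
moves the test function inside. -/
theorem HasWeakPartialDeriv.rayInt {k : Fin d} {r : ℝ} (hr : 0 < r) {h h' : Space d → ℝ}
    (hh : HasWeakPartialDeriv k h h') (hm : Measurable h) (hm' : Measurable h') :
    HasWeakPartialDeriv k (rayInt (fun ρ => ρ⁻¹) r h) (rayInt (fun _ => 1) r h') := by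
  have hw : ∀ ρ ∈ Set.uIoc 1 r, |ρ⁻¹| ≤ (min 1 r)⁻¹ := fun ρ hρ => by
    have hm : 0 < min 1 r := lt_min one_pos hr
    have := pos_of_mem_uIoc_one hr hρ
    rw [abs_of_pos (by positivity)]
    exact inv_anti₀ hm (mem_uIoc_one hρ).1
  have hw' : ∀ ρ ∈ Set.uIoc 1 r, |(1 : ℝ)| ≤ 1 := fun _ _ => by simp
  refine ⟨locallyIntegrable_rayInt hr measurable_inv hw hm hh.1,
    locallyIntegrable_rayInt hr measurable_const hw' hm' hh.2, fun φ hφ hφc => ?_⟩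
  simp only [smul_eq_mul]
  rw [integral_mul_rayInt hr measurable_inv hw hm hh.1 (continuous_partial hφ k)
    (hasCompactSupport_partial hφc k), integral_mul_rayInt hr measurable_const hw' hm' hh.2
    hφ.continuous hφc, ← intervalIntegral.integral_neg]
  refine intervalIntegral.integral_congr_ae (Eventually.of_forall fun ρ hρ => ?_)
  have hρ0 := (pos_of_mem_uIoc_one hr hρ).ne'
  have h1 := (hh.comp_smul hρ0).3 φ hφ hφc
  simp only [smul_eq_mul] at h1
  rw [h1, one_mul, mul_neg, ← integral_const_mul]
  congr 1
  refine integral_congr_ae (Eventually.of_forall fun x => ?_)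
  field_simp

theorem L1LocTendsto.rayInt {r : ℝ} (hr : 0 < r) {h : ℕ → Space d → ℝ} {k : Space d → ℝ}
    (hk : L1LocTendsto h k) (hm : ∀ n, Measurable (h n)) (hh : ∀ n, LocallyIntegrable (h n) volume)
    (hkm : Measurable k) (hki : LocallyIntegrable k volume) :
    L1LocTendsto (fun n => rayInt (fun _ => 1) r (h n)) (rayInt (fun _ => 1) r k) := by
  have hw : ∀ ρ ∈ Set.uIoc 1 r, |(1 : ℝ)| ≤ 1 := fun _ _ => by simp
  intro R
  rcases lt_or_ge R 0 with hR | hR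
  · simp [Metric.ball_eq_empty.2 hR.le]
  have h1 := ENNReal.Tendsto.mul_const (b := ENNReal.ofReal |r - 1|) (ENNReal.Tendsto.const_mul
    (a := ENNReal.ofReal ((min 1 r ^ d)⁻¹)) (hk (max 1 r * R)) (Or.inr (by simp)))
    (Or.inr (by simp))
  rw [mul_zero, zero_mul] at h1
  refine tendsto_of_tendsto_of_tendsto_of_le_of_le tendsto_const_nhds h1 (fun _ => zero_le)
    fun n => ?_
  refine le_trans ?_ (lintegral_ball_ray_le hr hR fun x => ‖h n x - k x‖ₑ)
  have hmeas : Measurable fun z : ℝ × Space d => ‖h n (z.1 • z.2) - k (z.1 • z.2)‖ₑ := by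
    have := hm n
    fun_prop
  rw [lintegral_lintegral_swap hmeas.aemeasurable]
  refine lintegral_mono_ae ?_
  filter_upwards [ae_restrict_of_ae (ae_intervalIntegrable_ray hr measurable_const hw (hm n) (hh n)),
    ae_restrict_of_ae (ae_intervalIntegrable_ray hr measurable_const hw hkm hki)] with x h2 h3
  simp only [MagneticLaplacian.rayInt]
  rw [← intervalIntegral.integral_sub h2 h3, ← ofReal_norm,
    intervalIntegral.norm_intervalIntegral_eq, ofReal_norm]
  refine (enorm_integral_le_lintegral_enorm _).trans_eq ?_
  simp

theorem L1LocTendsto.add {h h' : ℕ → Space d → ℝ} {k k' : Space d → ℝ} (hk : L1LocTendsto h k)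
    (hk' : L1LocTendsto h' k') (hm : ∀ n, Measurable (h n)) (hkm : Measurable k) :
    L1LocTendsto (fun n x => h n x + h' n x) (fun x => k x + k' x) := by
  intro R
  have h1 := (hk R).add (hk' R)
  rw [add_zero] at h1
  refine tendsto_of_tendsto_of_tendsto_of_le_of_le tendsto_const_nhds h1 (fun _ => zero_le)
    fun n => ?_
  simp only
  have hme : Measurable fun x => ‖h n x - k x‖ₑ := ((hm n).sub hkm).enorm
  rw [← lintegral_add_left hme]
  refine lintegral_mono fun x => ?_
  simp only
  rw [add_sub_add_comm]
  exact enorm_add_le _ _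

theorem L1LocTendsto.sum {ι : Type*} (s : Finset ι) {h : ι → ℕ → Space d → ℝ}
    {k : ι → Space d → ℝ} (hk : ∀ i ∈ s, L1LocTendsto (h i) (k i))
    (hm : ∀ i n, Measurable (h i n)) (hkm : ∀ i, Measurable (k i)) :
    L1LocTendsto (fun n x => ∑ i ∈ s, h i n x) (fun x => ∑ i ∈ s, k i x) := by
  classical
  induction s using Finset.induction_on with
  | empty => intro R; simp
  | insert i s hi ih =>
    simp only [Finset.sum_insert hi]
    exact (hk i (by simp)).add (ih fun k hk' => hk k (by simp [hk'])) (hm i) (hkm i)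

theorem L1LocTendsto.coord_mul {h : ℕ → Space d → ℝ} {k : Space d → ℝ} (hk : L1LocTendsto h k)
    (j : Fin d) : L1LocTendsto (fun n x => x j * h n x) (fun x => x j * k x) := by
  intro R
  have h1 := ENNReal.Tendsto.const_mul (a := ENNReal.ofReal R) (hk R) (Or.inr (by simp))
  rw [mul_zero] at h1
  refine tendsto_of_tendsto_of_tendsto_of_le_of_le tendsto_const_nhds h1 (fun _ => zero_le)
    fun n => ?_
  rw [← lintegral_const_mul' _ _ (by simp)]
  refine setLIntegral_mono' Metric.isOpen_ball.measurableSet fun x hx => ?_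
  rw [← mul_sub, enorm_mul]
  gcongr
  rw [← ofReal_norm]
  exact ENNReal.ofReal_le_ofReal
    ((PiLp.norm_apply_le x j).trans (mem_ball_zero_iff.1 hx).le)

theorem L1LocTendsto.comp_smul {h : ℕ → Space d → ℝ} {k : Space d → ℝ} (hk : L1LocTendsto h k)
    {r : ℝ} (hr : 0 < r) : L1LocTendsto (fun n x => h n (r • x)) (fun x => k (r • x)) := by
  intro R
  rcases lt_or_ge R 0 with hR | hR
  · simp [Metric.ball_eq_empty.2 hR.le]
  have h1 := ENNReal.Tendsto.const_mul (a := ENNReal.ofReal ((r ^ d)⁻¹)) (hk (r * R))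
    (Or.inr (by simp))
  rw [mul_zero] at h1
  refine tendsto_of_tendsto_of_tendsto_of_le_of_le tendsto_const_nhds h1 (fun _ => zero_le)
    fun n => le_of_eq ?_
  simp only
  rw [← lintegral_indicator Metric.isOpen_ball.measurableSet,
    ← lintegral_indicator Metric.isOpen_ball.measurableSet, ← lintegral_comp_smul_space hr]
  refine lintegral_congr fun x => ?_
  have : x ∈ Metric.ball (0 : Space d) R ↔ r • x ∈ Metric.ball (0 : Space d) (r * R) := by
    rw [mem_ball_zero_iff, mem_ball_zero_iff, norm_smul, Real.norm_of_nonneg hr.le,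
      mul_lt_mul_iff_right₀ hr]
  by_cases hx : x ∈ Metric.ball (0 : Space d) R
  · rw [Set.indicator_of_mem hx, Set.indicator_of_mem (this.1 hx)]
  · rw [Set.indicator_of_notMem hx, Set.indicator_of_notMem (mt this.2 hx)]

/-- At `ρ x` the integrand `f + y · ∇f` is the derivative of `ρ ↦ ρ f(ρ x)`. -/
theorem rayInt_radial_of_contDiff {f : Space d → ℝ} (hf : ContDiff ℝ 1 f) (r : ℝ)
    (x : Space d) :
    rayInt (fun _ => 1) r
      (fun y => f y + ∑ j, y j * fderiv ℝ f y (EuclideanSpace.single j 1)) x =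
      r * f (r • x) - f x := by
  have hsum : ∀ y : Space d, ∑ j, y j * fderiv ℝ f y (EuclideanSpace.single j 1) =
      fderiv ℝ f y y := fun y => by
    have h1 := congrArg (fderiv ℝ f y) ((EuclideanSpace.basisFun (Fin d) ℝ).sum_repr y)
    rw [map_sum] at h1
    simpa using h1
  have hd : ∀ ρ : ℝ, HasDerivAt (fun ρ => ρ * f (ρ • x))
      (1 * (f (ρ • x) + ∑ j, (ρ • x) j * fderiv ℝ f (ρ • x) (EuclideanSpace.single j 1))) ρ :=
    fun ρ => by
    have h1 : HasDerivAt (fun ρ : ℝ => ρ • x) x ρ := by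
      simpa using (hasDerivAt_id ρ).smul_const x
    have h2 := ((hf.differentiable one_ne_zero (ρ • x)).hasFDerivAt.comp_hasDerivAt ρ h1)
    have h3 := (hasDerivAt_id ρ).mul h2
    rw [hsum]
    exact h3.congr_deriv (by simp)
  rw [rayInt, intervalIntegral.integral_eq_sub_of_hasDerivAt (fun ρ _ => hd ρ)]
  · simp
  · refine Continuous.intervalIntegrable ?_ _ _
    simp only [hsum]
    have hs : Continuous fun ρ : ℝ => ρ • x := continuous_id.smul continuous_const
    exact continuous_const.mul ((hf.continuous.comp hs).add
      (((hf.continuous_fderiv one_ne_zero).comp hs).clm_apply hs))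

/-- The fundamental theorem of calculus along rays for weakly differentiable functions. -/
theorem rayInt_radial {r : ℝ} (hr : 0 < r) {f : Space d → ℝ} {g : Fin d → Space d → ℝ}
    (h : ∀ j, HasWeakPartialDeriv j f (g j)) (hfi : LocallyIntegrable f volume)
    (hfm : Measurable f) (hgm : ∀ j, Measurable (g j)) :
    ∀ᵐ x, rayInt (fun _ => 1) r (fun y => f y + ∑ j, y j * g j y) x = r * f (r • x) - f x := by
  have hw : ∀ ρ ∈ Set.uIoc 1 r, |(1 : ℝ)| ≤ 1 := fun _ _ => by simp
  have hmulm : ∀ {u : Space d → ℝ} (j : Fin d), Measurable u →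
      Measurable fun y : Space d => y j * u y := fun j hu =>
    (contDiff_coord j).continuous.measurable.mul hu
  have hmuli : ∀ {u : Space d → ℝ} (j : Fin d), LocallyIntegrable u volume →
      LocallyIntegrable (fun y : Space d => y j * u y) volume := fun j hu =>
    locallyIntegrable_smul_continuous hu (contDiff_coord j).continuous
  have hsumi : ∀ {u : Fin d → Space d → ℝ}, (∀ j, LocallyIntegrable (u j) volume) →
      LocallyIntegrable (fun y : Space d => ∑ j, y j * u j y) volume := fun hu => by
    have := locallyIntegrable_finsetSum Finset.univ fun j _ => hmuli j (hu j)
    exact this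
  have hkm : Measurable fun y : Space d => f y + ∑ j, y j * g j y :=
    hfm.add (Finset.measurable_fun_sum _ fun j _ => hmulm j (hgm j))
  have hki : LocallyIntegrable (fun y : Space d => f y + ∑ j, y j * g j y) volume :=
    hfi.add (hsumi fun j => (h j).2)
  have hri : LocallyIntegrable (fun x => r * f (r • x) - f x) volume :=
    ((locallyIntegrable_comp_smul hfi hr.ne').smul r).sub hfi
  -- Both sides are continuous under local `L¹` convergence of `f` and its derivatives, so the
  -- smooth identity for mollifications passes to the limit against every test function.
  refine ae_eq_of_integral_contDiff_smul_eq
    (locallyIntegrable_rayInt hr measurable_const hw hkm hki) hri fun φ hφ hφc => ?_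
  have hfn := fun n => contDiff_mollify n hfi
  have hgn := fun j n => contDiff_mollify n (h j).2
  have hfnm := fun n => (hfn n).continuous.measurable
  have hgnm := fun j n => (hgn j n).continuous.measurable
  have t0 : L1LocTendsto (fun n y => mollify n f y + ∑ j, y j * mollify n (g j) y)
      (fun y => f y + ∑ j, y j * g j y) :=
    (l1LocTendsto_mollify hfi).add (L1LocTendsto.sum Finset.univ
      (fun j _ => (l1LocTendsto_mollify (h j).2).coord_mul j)
      (fun j n => hmulm j (hgnm j n)) fun j => hmulm j (hgm j)) hfnm hfm
  have hnm : ∀ n, Measurable fun y => mollify n f y + ∑ j, y j * mollify n (g j) y := fun n =>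
    (hfnm n).add (Finset.measurable_fun_sum _ fun j _ => hmulm j (hgnm j n))
  have hni : ∀ n, LocallyIntegrable
      (fun y => mollify n f y + ∑ j, y j * mollify n (g j) y) volume := fun n =>
    (hfn n).continuous.locallyIntegrable.add
      (hsumi fun j => (hgn j n).continuous.locallyIntegrable)
  have t1 := (t0.rayInt hr hnm hni hkm hki).tendsto_integral_smul
    (fun n => locallyIntegrable_rayInt hr measurable_const hw (hnm n) (hni n))
    (locallyIntegrable_rayInt hr measurable_const hw hkm hki) hφ.continuous hφc
  have t2 := ((l1LocTendsto_mollify hfi).comp_smul hr).tendsto_integral_smul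
    (fun n => locallyIntegrable_comp_smul (hfn n).continuous.locallyIntegrable hr.ne')
    (locallyIntegrable_comp_smul hfi hr.ne') hφ.continuous hφc
  have t3 := (l1LocTendsto_mollify hfi).tendsto_integral_smul
    (fun n => (hfn n).continuous.locallyIntegrable) hfi hφ.continuous hφc
  have hsplit : ∀ {u : Space d → ℝ}, LocallyIntegrable u volume →
      ∫ x, φ x • (r * u (r • x) - u x) =
      (r * ∫ x, φ x • u (r • x)) - ∫ x, φ x • u x := fun hu => by
    have i1 := integrable_test (locallyIntegrable_comp_smul hu hr.ne') hφ.continuous hφc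
    have i2 := integrable_test hu hφ.continuous hφc
    rw [← integral_const_mul, ← integral_sub (i1.const_mul r) i2]
    refine integral_congr_ae (Eventually.of_forall fun x => ?_)
    simp only [smul_eq_mul]
    ring
  rw [hsplit hfi]
  refine tendsto_nhds_unique t1 (((t2.const_mul r).sub t3).congr fun n => ?_)
  rw [← hsplit (hfn n).continuous.locallyIntegrable]
  refine integral_congr_ae (Eventually.of_forall fun x => ?_)
  simp only
  rw [← rayInt_radial_of_contDiff (hfn n) r x]
  simp only [fun y j => fderiv_mollify (h j) n y]

end RayIntegral

/-! ### The gauge phase attached to a dilation. -/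

section Gauge

variable {d : ℕ}

/-- A measurable magnetic potential with locally square integrable weak derivatives
`a j k = ∂_j A_k`. -/
structure IsRegularPotential (A : Space d → Space d) (a : Fin d → Fin d → Space d → ℝ) : Prop where
  measurable_apply : ∀ k, Measurable fun x => A x k
  measurable_deriv : ∀ j k, Measurable (a j k)
  memLpLoc_deriv : ∀ j k, MemLpLoc (a j k) 2
  hasWeakPartialDeriv : ∀ j k, HasWeakPartialDeriv j (fun x => A x k) (a j k)

/-- The components of the field `xᵀ B`. -/
def radialField (a : Fin d → Fin d → Space d → ℝ) (k : Fin d) (x : Space d) : ℝ :=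
  ∑ j, x j * (a j k x - a k j x)

/-- The circulation of `A` along the segment from `x` to `r x`. -/
def gaugePhase (A : Space d → Space d) (r : ℝ) : Space d → ℝ :=
  rayInt (fun ρ => ρ⁻¹) r fun y => ∑ j, y j * A y j

/-- The segment from `r x` back to `x` is the original one reversed, and `dρ / ρ` is scale
invariant. This is what makes `D_{1/r}` the adjoint of `D_r`. -/
theorem gaugePhase_inv_smul (A : Space d → Space d) {r : ℝ} (hr : r ≠ 0) (x : Space d) :
    gaugePhase A r⁻¹ (r • x) = -gaugePhase A r x := by
  have h := intervalIntegral.integral_comp_mul_right (a := 1) (b := r⁻¹)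
    (fun ρ => ρ⁻¹ * ∑ j, (ρ • x) j * A (ρ • x) j) hr
  rw [one_mul, inv_mul_cancel₀ hr, eq_inv_smul_iff₀ hr] at h
  simp only [gaugePhase, rayInt]
  rw [← intervalIntegral.integral_symm, ← h, smul_eq_mul, ← intervalIntegral.integral_const_mul]
  refine intervalIntegral.integral_congr fun ρ _ => ?_
  simp only [smul_smul]
  field_simp

theorem measurable_coord_mul {u : Space d → ℝ} (j : Fin d) (hu : Measurable u) :
    Measurable fun y : Space d => y j * u y :=
  (contDiff_coord j).continuous.measurable.mul hu

theorem locallyIntegrable_coord_mul {u : Space d → ℝ} (j : Fin d)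
    (hu : LocallyIntegrable u volume) :
    LocallyIntegrable (fun y : Space d => y j * u y) volume :=
  locallyIntegrable_smul_continuous hu (contDiff_coord j).continuous

theorem locallyIntegrable_sum_coord_mul {u : Fin d → Space d → ℝ}
    (hu : ∀ j, LocallyIntegrable (u j) volume) :
    LocallyIntegrable (fun y : Space d => ∑ j, y j * u j y) volume :=
  locallyIntegrable_finsetSum Finset.univ fun j _ => locallyIntegrable_coord_mul j (hu j)

variable {A : Space d → Space d} {a : Fin d → Fin d → Space d → ℝ}

theorem IsRegularPotential.measurable_radialField (hA : IsRegularPotential A a) (k : Fin d) :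
    Measurable (radialField a k) :=
  Finset.measurable_fun_sum _ fun j _ =>
    measurable_coord_mul j ((hA.measurable_deriv j k).sub (hA.measurable_deriv k j))

theorem IsRegularPotential.locallyIntegrable_radialField (hA : IsRegularPotential A a)
    (k : Fin d) : LocallyIntegrable (radialField a k) volume :=
  locallyIntegrable_sum_coord_mul fun j =>
    (hA.hasWeakPartialDeriv j k).2.sub (hA.hasWeakPartialDeriv k j).2

theorem abs_inv_le_of_mem_uIoc {r : ℝ} (hr : 0 < r) : ∀ ρ ∈ Set.uIoc 1 r, |ρ⁻¹| ≤ (min 1 r)⁻¹ :=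
  fun ρ hρ => by
    have hm : 0 < min 1 r := lt_min one_pos hr
    have := pos_of_mem_uIoc_one hr hρ
    rw [abs_of_pos (by positivity)]
    exact inv_anti₀ hm (mem_uIoc_one hρ).1

theorem IsRegularPotential.measurable_radial (hA : IsRegularPotential A a) :
    Measurable fun y : Space d => ∑ j, y j * A y j :=
  Finset.measurable_fun_sum _ fun j _ => measurable_coord_mul j (hA.measurable_apply j)

theorem IsRegularPotential.locallyIntegrable_radial (hA : IsRegularPotential A a) :
    LocallyIntegrable (fun y : Space d => ∑ j, y j * A y j) volume :=
  locallyIntegrable_sum_coord_mul fun j => (hA.hasWeakPartialDeriv j j).1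

theorem IsRegularPotential.aestronglyMeasurable_gaugePhase (hA : IsRegularPotential A a) {r : ℝ}
    (hr : 0 < r) : AEStronglyMeasurable (gaugePhase A r) volume :=
  (locallyIntegrable_rayInt hr measurable_inv (abs_inv_le_of_mem_uIoc hr) hA.measurable_radial
    hA.locallyIntegrable_radial).aestronglyMeasurable

/-- On almost every ray the integrand is integrable over `[1, 2]`, and a primitive is continuous.
The exceptional null set does not depend on `r`. -/
theorem IsRegularPotential.tendsto_gaugePhase (hA : IsRegularPotential A a) :
    ∀ᵐ x, Tendsto (fun r => gaugePhase A r x) (𝓝[>] 1) (𝓝 0) := by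
  filter_upwards [ae_intervalIntegrable_ray two_pos measurable_inv
    (abs_inv_le_of_mem_uIoc two_pos) hA.measurable_radial hA.locallyIntegrable_radial] with x hx
  have h1 := intervalIntegral.continuousOn_primitive_interval (μ := volume) (a := (1 : ℝ)) (b := 2)
    (f := fun ρ => ρ⁻¹ * ∑ j, (ρ • x) j * A (ρ • x) j)
    (by
      have := (intervalIntegrable_iff_integrableOn_Icc_of_le one_le_two).1 hx
      rwa [Set.uIcc_of_le one_le_two])
  have h2 := h1 1 Set.left_mem_uIcc
  rw [ContinuousWithinAt, intervalIntegral.integral_same, Set.uIcc_of_le one_le_two] at h2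
  refine h2.mono_left ?_
  rw [← nhdsWithin_Ioc_eq_nhdsGT one_lt_two]
  exact nhdsWithin_mono _ Set.Ioc_subset_Icc_self

/-- Differentiating under the ray integral gives `∂_k (y · A) = A_k + ∑ y_j ∂_k A_j`. Replacing `∂_k
A_j` by `∂_j A_k - B_jk` leaves the Euler expression `A_k + y · ∇A_k`, which integrates to `r A_k(r
x) - A_k(x)` by `rayInt_radial`, minus the ray integral of `xᵀB`. -/
theorem IsRegularPotential.hasWeakPartialDeriv_gaugePhase (hA : IsRegularPotential A a) {r : ℝ}
    (hr : 0 < r) (k : Fin d) :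
    HasWeakPartialDeriv k (gaugePhase A r) fun x =>
      r * A (r • x) k - A x k - rayInt (fun _ => 1) r (radialField a k) x := by
  have hw : ∀ ρ ∈ Set.uIoc 1 r, |(1 : ℝ)| ≤ 1 := fun _ _ => by simp
  have hd : HasWeakPartialDeriv k (fun y : Space d => ∑ j, y j * A y j)
      (fun y => A y k + ∑ j, y j * a k j y) := by
    have h1 := HasWeakPartialDeriv.sum Finset.univ fun (j : Fin d) _ =>
      (hA.hasWeakPartialDeriv k j).smooth_smul (contDiff_coord j)
    simp only [fderiv_coord, smul_eq_mul, Finset.sum_add_distrib, ite_mul, one_mul, zero_mul,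
      Finset.sum_ite_eq', Finset.mem_univ, if_true] at h1
    exact h1
  have hm' : Measurable fun y : Space d => A y k + ∑ j, y j * a k j y :=
    (hA.measurable_apply k).add (Finset.measurable_fun_sum _ fun j _ =>
      measurable_coord_mul j (hA.measurable_deriv k j))
  have hm'' : Measurable fun y : Space d => A y k + ∑ j, y j * a j k y :=
    (hA.measurable_apply k).add (Finset.measurable_fun_sum _ fun j _ =>
      measurable_coord_mul j (hA.measurable_deriv j k))
  have hi'' : LocallyIntegrable (fun y : Space d => A y k + ∑ j, y j * a j k y) volume :=
    (hA.hasWeakPartialDeriv k k).1.add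
      (locallyIntegrable_sum_coord_mul fun j => (hA.hasWeakPartialDeriv j k).2)
  refine (hd.rayInt hr hA.measurable_radial hm').congr_ae EventuallyEq.rfl ?_
  filter_upwards [rayInt_radial hr (fun j => hA.hasWeakPartialDeriv j k)
      (hA.hasWeakPartialDeriv k k).1 (hA.measurable_apply k) (fun j => hA.measurable_deriv j k),
    ae_intervalIntegrable_ray hr measurable_const hw hm'' hi'',
    ae_intervalIntegrable_ray hr measurable_const hw (hA.measurable_radialField k)
      (hA.locallyIntegrable_radialField k)] with x h1 h2 h3
  rw [← h1]
  simp only [rayInt]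
  rw [← intervalIntegral.integral_sub h2 h3]
  refine intervalIntegral.integral_congr fun ρ _ => ?_
  simp only [radialField, one_mul, mul_sub, Finset.sum_sub_distrib]
  ring

end Gauge

/-! ### Magnetic dilations and their commutator with the magnetic gradient. -/

section Dilation

variable {d : ℕ} {E : Type*} [NormedAddCommGroup E] [NormedSpace ℂ E]

/-- The magnetic dilation `f ↦ r^(d/2) e^(-iθ_r) f(r ·)`. -/
def dilate (A : Space d → Space d) (r : ℝ) (f : Space d → E) (x : Space d) : E :=
  ((√(r ^ d) : ℂ) * Complex.exp (-(Complex.I * (gaugePhase A r x : ℂ)))) • f (r • x)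

theorem norm_exp_neg_I_mul (s : ℝ) : ‖Complex.exp (-(Complex.I * (s : ℂ)))‖ = 1 := by
  rw [← mul_neg, mul_comm, ← Complex.ofReal_neg, Complex.norm_exp_ofReal_mul_I]

theorem norm_dilate (A : Space d → Space d) (r : ℝ) (f : Space d → E) (x : Space d) :
    ‖dilate A r f x‖ = √(r ^ d) * ‖f (r • x)‖ := by
  rw [dilate, norm_smul, norm_mul, norm_exp_neg_I_mul, mul_one, Complex.norm_real,
    Real.norm_of_nonneg (Real.sqrt_nonneg _)]

theorem enorm_dilate_sq (A : Space d → Space d) {r : ℝ} (hr : 0 < r) (f : Space d → E)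
    (x : Space d) : ‖dilate A r f x‖ₑ ^ 2 = ENNReal.ofReal (r ^ d) * ‖f (r • x)‖ₑ ^ 2 := by
  rw [← ofReal_norm, ← ofReal_norm, norm_dilate, ENNReal.ofReal_mul (Real.sqrt_nonneg _), mul_pow,
    ← ENNReal.ofReal_pow (Real.sqrt_nonneg _), Real.sq_sqrt (by positivity)]

variable {A : Space d → Space d} {a : Fin d → Fin d → Space d → ℝ}

theorem IsRegularPotential.aestronglyMeasurable_dilate (hA : IsRegularPotential A a) {r : ℝ}
    (hr : 0 < r) {f : Space d → E} (hf : AEStronglyMeasurable f volume) :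
    AEStronglyMeasurable (dilate A r f) volume := by
  have h1 : AEStronglyMeasurable (fun x => f (r • x)) volume :=
    hf.comp_quasiMeasurePreserving (quasiMeasurePreserving_smul hr.ne')
  have h2 : Continuous fun s : ℝ => (√(r ^ d) : ℂ) * Complex.exp (-(Complex.I * (s : ℂ))) := by
    fun_prop
  exact (h2.comp_aestronglyMeasurable (hA.aestronglyMeasurable_gaugePhase hr)).smul h1

theorem eLpNorm_two_sq {E : Type*} [NormedAddCommGroup E] {f : Space d → E} :
    eLpNorm f 2 volume ^ 2 = ∫⁻ x, ‖f x‖ₑ ^ 2 := by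
  have := eLpNorm_nnreal_pow_eq_lintegral (f := f) (μ := (volume : Measure (Space d)))
    (p := 2) two_ne_zero
  simpa using this

theorem eLpNorm_dilate {r : ℝ} (hr : 0 < r) (f : Space d → E) :
    eLpNorm (dilate A r f) 2 volume = eLpNorm f 2 volume := by
  refine (ENNReal.pow_right_strictMono two_ne_zero).injective ?_
  rw [eLpNorm_two_sq, eLpNorm_two_sq]
  simp only [enorm_dilate_sq A hr]
  rw [lintegral_const_mul' _ _ (by simp), lintegral_comp_smul_space hr fun x => ‖f x‖ₑ ^ 2,
    ← mul_assoc, ← ENNReal.ofReal_mul (by positivity), mul_inv_cancel₀ (by positivity)]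
  simp

theorem IsRegularPotential.memLp_dilate (hA : IsRegularPotential A a) {r : ℝ} (hr : 0 < r)
    {f : Space d → E} (hf : MemLp f 2 volume) : MemLp (dilate A r f) 2 volume :=
  ⟨hA.aestronglyMeasurable_dilate hr hf.1, by rw [eLpNorm_dilate hr]; exact hf.2⟩

/-- `G = ∇_A u` for functions. -/
def HasMagGrad (A : Space d → Space d) (u : Space d → ℂ)
    (G : Space d → EuclideanSpace ℂ (Fin d)) : Prop :=
  ∀ j : Fin d, HasWeakPartialDeriv j u (fun x => G x j + Complex.I * (A x j : ℂ) * u x)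

/-- The commutator of the magnetic gradient and the magnetic dilation. -/
def dilationError (A : Space d → Space d) (a : Fin d → Fin d → Space d → ℝ) (r : ℝ)
    (u : Space d → ℂ) (x : Space d) : EuclideanSpace ℂ (Fin d) :=
  WithLp.toLp 2 fun k =>
    Complex.I * (rayInt (fun _ => 1) r (radialField a k) x : ℂ) * dilate A r u x

/-- Multiplication by a phase. -/
def phaseMul (p : ℝ × ℂ) : ℂ := Complex.exp (-(Complex.I * (p.1 : ℂ))) * p.2

theorem contDiff_phaseMul : ContDiff ℝ 1 phaseMul := by
  have h1 : ContDiff ℝ 1 fun p : ℝ × ℂ => (p.1 : ℂ) := Complex.ofRealCLM.contDiff.comp contDiff_fst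
  exact ((contDiff_const.mul h1).neg.cexp).mul contDiff_snd

theorem fderiv_phaseMul (p q : ℝ × ℂ) : fderiv ℝ phaseMul p q =
    Complex.exp (-(Complex.I * (p.1 : ℂ))) * (q.2 - Complex.I * (q.1 : ℂ) * p.2) := by
  have h1 : HasFDerivAt (fun p : ℝ × ℂ => (p.1 : ℂ))
      (Complex.ofRealCLM.comp (ContinuousLinearMap.fst ℝ ℝ ℂ)) p :=
    (Complex.ofRealCLM.comp (ContinuousLinearMap.fst ℝ ℝ ℂ)).hasFDerivAt
  have h2 := ((h1.const_mul Complex.I).neg.cexp).mul (hasFDerivAt_snd (𝕜 := ℝ) (p := p))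
  have h3 : fderiv ℝ phaseMul p = _ := h2.fderiv
  rw [h3]
  simp
  ring

/-- The phase is chosen so that its gradient trades the scaled potential `r A(r x)` for `A(x)`, up
to the ray integral of `xᵀB`. Boundedness of `u` is there for the chain rule: the derivative of `(θ,
z) ↦ e^(-iθ) z` grows with `|z|` and is at most `1 + M` on the slab `|z| ≤ M`. -/
theorem IsRegularPotential.hasMagGrad_dilate (hA : IsRegularPotential A a) {r : ℝ} (hr : 0 < r)
    {u : Space d → ℂ} {G : Space d → EuclideanSpace ℂ (Fin d)} (h : HasMagGrad A u G) {M : ℝ}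
    (hM : ∀ x, ‖u x‖ ≤ M) :
    HasMagGrad A (dilate A r u) fun x => (r : ℂ) • dilate A r G x + dilationError A a r u x := by
  intro k
  have h1 := (hA.hasWeakPartialDeriv_gaugePhase hr k).prodMk ((h k).comp_smul hr.ne')
  have hM0 : 0 ≤ M := (norm_nonneg _).trans (hM 0)
  have hC : Convex ℝ {p : ℝ × ℂ | ‖p.2‖ ≤ M} := by
    have : {p : ℝ × ℂ | ‖p.2‖ ≤ M} = Prod.snd ⁻¹' (Metric.closedBall 0 M) := by ext; simp
    rw [this]
    exact (convex_closedBall (0 : ℂ) M).linear_preimage (LinearMap.snd ℝ ℝ ℂ)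
  have hC' : IsClosed {p : ℝ × ℂ | ‖p.2‖ ≤ M} :=
    isClosed_le continuous_snd.norm continuous_const
  have hK : ∀ z ∈ {p : ℝ × ℂ | ‖p.2‖ ≤ M}, ‖fderiv ℝ phaseMul z‖ ≤ 1 + M := fun z hz => by
    refine ContinuousLinearMap.opNorm_le_bound _ (by positivity) fun q => ?_
    rw [fderiv_phaseMul, norm_mul, norm_exp_neg_I_mul, one_mul]
    refine (norm_sub_le _ _).trans ?_
    rw [norm_mul, norm_mul, Complex.norm_I, one_mul, Complex.norm_real, add_mul, one_mul, mul_comm]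
    refine add_le_add (norm_snd_le q) (mul_le_mul hz (norm_fst_le q) (norm_nonneg _) hM0)
  have h2 := (h1.comp contDiff_phaseMul hC hC' (fun x => hM _) hK).const_mul (√(r ^ d) : ℂ)
  refine h2.congr_ae (Eventually.of_forall fun x => ?_) (Eventually.of_forall fun x => ?_)
  · simp only [phaseMul, dilate, smul_eq_mul]
    ring
  · simp only [fderiv_phaseMul, dilate, dilationError, PiLp.add_apply, PiLp.smul_apply, smul_eq_mul,
      Complex.real_smul]
    push_cast
    ring_nf

end Dilation

/-! ### The commutator estimate. -/

section Estimate

theorem sq_lintegral_le {α : Type*} [MeasurableSpace α] (μ : Measure α) {f : α → ℝ≥0∞}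
    (hf : AEMeasurable f μ) : (∫⁻ x, f x ∂μ) ^ 2 ≤ μ Set.univ * ∫⁻ x, f x ^ 2 ∂μ := by
  have h := ENNReal.lintegral_mul_le_Lp_mul_Lq μ Real.HolderConjugate.two_two hf
    (aemeasurable_const (b := (1 : ℝ≥0∞)))
  simp only [Pi.mul_apply, mul_one, ENNReal.rpow_ofNat, one_pow, lintegral_const, one_mul] at h
  have h2 := pow_le_pow_left₀ zero_le h 2
  have e : ∀ z : ℝ≥0∞, (z ^ (1 / 2 : ℝ)) ^ 2 = z := fun z => by
    rw [← ENNReal.rpow_natCast, ← ENNReal.rpow_mul]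
    norm_num
  rw [mul_pow, e, e] at h2
  rwa [mul_comm]

theorem enorm_sq_euclideanSpace {d : ℕ} {𝕜 : Type*} [RCLike 𝕜] (v : EuclideanSpace 𝕜 (Fin d)) :
    ‖v‖ₑ ^ 2 = ∑ k, ‖v k‖ₑ ^ 2 := by
  simp only [← ofReal_norm, ← ENNReal.ofReal_pow (norm_nonneg _)]
  rw [EuclideanSpace.norm_sq_eq, ENNReal.ofReal_sum_of_nonneg fun _ _ => by positivity]

variable {d : ℕ} {A : Space d → Space d} {a : Fin d → Fin d → Space d → ℝ}

/-- The field `xᵀ B`. -/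
def radialVec (a : Fin d → Fin d → Space d → ℝ) (x : Space d) : Space d :=
  WithLp.toLp 2 fun k => radialField a k x

theorem IsRegularPotential.measurable_radialVec (hA : IsRegularPotential A a) :
    Measurable (radialVec a) :=
  (PiLp.continuous_toLp 2 _).measurable.comp
    (measurable_pi_iff.2 fun k => hA.measurable_radialField k)

/-- On a ball the coordinates are bounded and the derivatives of `A` are square integrable. This
supplies the finiteness behind the later absorption. -/
theorem IsRegularPotential.lintegral_ball_radialVec_lt_top (hA : IsRegularPotential A a) (R : ℝ) :
    ∫⁻ x in Metric.ball 0 R, ‖radialVec a x‖ₑ ^ 2 < ⊤ := by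
  have h1 : ∀ k, MemLp (radialField a k) 2 (volume.restrict (Metric.ball 0 R)) := fun k => by
    refine memLp_finsetSum (f := fun j x => x j * (a j k x - a k j x)) _ fun j _ => ?_
    have h2 : MemLp (fun x => a j k x - a k j x) 2 (volume.restrict (Metric.ball 0 R)) :=
      ((hA.memLpLoc_deriv j k _ (isCompact_closedBall 0 R)).sub
        (hA.memLpLoc_deriv k j _ (isCompact_closedBall 0 R))).mono_measure
        (Measure.restrict_mono Metric.ball_subset_closedBall le_rfl)
    refine h2.of_le_mul (c := R) ?_ ?_
    · exact (contDiff_coord j).continuous.aestronglyMeasurable.mul h2.1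
    · refine (ae_restrict_iff' Metric.isOpen_ball.measurableSet).2 (Eventually.of_forall ?_)
      intro x hx
      rw [norm_mul]
      gcongr
      exact (PiLp.norm_apply_le x j).trans (mem_ball_zero_iff.1 hx).le
  simp only [enorm_sq_euclideanSpace]
  rw [lintegral_finsetSum _ fun k _ => by
    exact (hA.measurable_radialField k).enorm.pow_const 2]
  refine ENNReal.sum_lt_top.2 fun k _ => ?_
  have h2 := (h1 k).2
  have h3 : eLpNorm (radialField a k) 2 (volume.restrict (Metric.ball 0 R)) ^ 2 =
      ∫⁻ x in Metric.ball 0 R, ‖radialField a k x‖ₑ ^ 2 := by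
    have := eLpNorm_nnreal_pow_eq_lintegral (f := radialField a k)
      (μ := (volume : Measure (Space d)).restrict (Metric.ball 0 R)) (p := 2) two_ne_zero
    simpa using this
  exact h3 ▸ ENNReal.pow_lt_top h2

/-- The `L²` norm of `|xᵀ B| |u|`. -/
def fieldNorm (a : Fin d → Fin d → Space d → ℝ) (u : Space d → ℂ) : ℝ≥0∞ :=
  eLpNorm (fun x => ‖radialVec a x‖ * ‖u x‖) 2 volume

theorem fieldNorm_sq (u : Space d → ℂ) :
    fieldNorm a u ^ 2 = ∫⁻ x, ‖radialVec a x‖ₑ ^ 2 * ‖u x‖ₑ ^ 2 := by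
  rw [fieldNorm, eLpNorm_two_sq]
  refine lintegral_congr fun x => ?_
  rw [enorm_mul, enorm_norm, enorm_norm, mul_pow]

/-- Cauchy-Schwarz in the ray parameter, component by component; the interval has length `|r - 1|`.
-/
theorem enorm_dilationError_sq_le (hA : IsRegularPotential A a) (r : ℝ) (u : Space d → ℂ)
    (x : Space d) : ‖dilationError A a r u x‖ₑ ^ 2 ≤
      ENNReal.ofReal |r - 1| * ∫⁻ ρ in Set.uIoc 1 r,
        ‖radialVec a (ρ • x)‖ₑ ^ 2 * ‖dilate A r u x‖ₑ ^ 2 := by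
  have hm : ∀ k, Measurable fun ρ : ℝ => ‖radialField a k (ρ • x)‖ₑ := fun k =>
    ((hA.measurable_radialField k).comp (by fun_prop)).enorm
  rw [lintegral_mul_const' _ _ (by finiteness), ← mul_assoc]
  simp only [enorm_sq_euclideanSpace]
  rw [lintegral_finsetSum _ fun k _ => by exact (hm k).pow_const 2, Finset.mul_sum, Finset.sum_mul]
  refine Finset.sum_le_sum fun k _ => ?_
  simp only [dilationError, radialVec]
  rw [enorm_mul, enorm_mul, mul_pow, mul_pow]
  have h1 : ‖(rayInt (fun _ => 1) r (radialField a k) x : ℂ)‖ₑ ≤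
      ∫⁻ ρ in Set.uIoc 1 r, ‖radialField a k (ρ • x)‖ₑ := by
    rw [← ofReal_norm, Complex.norm_real, rayInt, intervalIntegral.norm_intervalIntegral_eq,
      ofReal_norm]
    refine (enorm_integral_le_lintegral_enorm _).trans_eq ?_
    simp
  have h2 := sq_lintegral_le (volume.restrict (Set.uIoc 1 r)) (hm k).aemeasurable
  rw [Measure.restrict_apply_univ, Real.volume_uIoc] at h2
  have h3 : ‖Complex.I‖ₑ = 1 := by rw [← ofReal_norm, Complex.norm_I, ENNReal.ofReal_one]
  rw [h3, one_pow, one_mul]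
  gcongr ?_ * _
  exact (pow_le_pow_left₀ zero_le h1 2).trans h2

theorem IsRegularPotential.aestronglyMeasurable_dilationError (hA : IsRegularPotential A a) {r : ℝ}
    (hr : 0 < r) {u : Space d → ℂ} (hu : AEStronglyMeasurable u volume) :
    AEStronglyMeasurable (dilationError A a r u) volume := by
  refine (PiLp.continuous_toLp 2 _).comp_aestronglyMeasurable
    (aemeasurable_pi_iff.2 fun k => AEStronglyMeasurable.aemeasurable ?_).aestronglyMeasurable
  have hw : ∀ ρ ∈ Set.uIoc 1 r, |(1 : ℝ)| ≤ 1 := fun _ _ => by simp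
  exact ((Complex.continuous_ofReal.comp_aestronglyMeasurable
    (locallyIntegrable_rayInt hr measurable_const hw (hA.measurable_radialField k)
      (hA.locallyIntegrable_radialField k)).aestronglyMeasurable).const_mul _).mul
    (hA.aestronglyMeasurable_dilate hr hu)

theorem div_mem_Icc_of_mem_uIoc {r r₀ ρ : ℝ} (hr₀ : 1 ≤ r₀) (hr : r ∈ Set.Icc r₀⁻¹ r₀)
    (hρ : ρ ∈ Set.uIoc 1 r) : r / ρ ∈ Set.Icc r₀⁻¹ r₀ := by
  have hr0 : 0 < r := (inv_pos.2 (by linarith)).trans_le hr.1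
  have hρ0 := pos_of_mem_uIoc_one hr0 hρ
  have hinv : r₀⁻¹ ≤ 1 := inv_le_one_of_one_le₀ hr₀
  rw [Set.mem_Icc, le_div_iff₀ hρ0, div_le_iff₀ hρ0]
  rcases Set.mem_uIoc.1 hρ with h | h
  · constructor <;> nlinarith [hr.1, hr.2]
  · constructor <;> nlinarith [hr.1, hr.2]

/-- After Fubini, `y = ρ x` turns `|D_r u(x)|² dx` into `|D_{r/ρ} u(y)|² dy`: moduli ignore the
phases. So each slice is a squared `fieldNorm` of `D_{r/ρ} u`, with `r/ρ` again in the interval.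
Cauchy-Schwarz gives one factor `|r - 1|` and the length of integration the other. -/
theorem eLpNorm_dilationError_le (hA : IsRegularPotential A a) {r₀ : ℝ} (hr₀ : 1 ≤ r₀)
    {u : Space d → ℂ} (hu : Measurable u) {σ : ℝ≥0∞}
    (hσ : ∀ q ∈ Set.Icc r₀⁻¹ r₀, fieldNorm a (dilate A q u) ≤ σ) {r : ℝ}
    (hr : r ∈ Set.Icc r₀⁻¹ r₀) :
    eLpNorm (dilationError A a r u) 2 volume ≤ ENNReal.ofReal |r - 1| * σ := by
  have hr0 : 0 < r := (inv_pos.2 (by linarith)).trans_le hr.1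
  rw [← ENNReal.pow_le_pow_left_iff two_ne_zero, eLpNorm_two_sq, mul_pow, sq, mul_assoc]
  refine (lintegral_mono fun x => enorm_dilationError_sq_le hA r u x).trans ?_
  rw [lintegral_const_mul' _ _ (by simp)]
  gcongr
  simp only [enorm_dilate_sq A hr0]
  have hm : Measurable fun z : Space d × ℝ => ‖radialVec a (z.2 • z.1)‖ₑ ^ 2 *
      (ENNReal.ofReal (r ^ d) * ‖u (r • z.1)‖ₑ ^ 2) := by
    have := hA.measurable_radialVec
    fun_prop
  rw [lintegral_lintegral_swap hm.aemeasurable]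
  calc _ ≤ ∫⁻ _ in Set.uIoc 1 r, σ ^ 2 := by
        refine setLIntegral_mono' measurableSet_uIoc fun ρ hρ => ?_
        have hρ0 := pos_of_mem_uIoc_one hr0 hρ
        have hq0 : 0 < r / ρ := div_pos hr0 hρ0
        have h1 := hσ _ (div_mem_Icc_of_mem_uIoc hr₀ hr hρ)
        rw [← ENNReal.pow_le_pow_left_iff two_ne_zero, fieldNorm_sq] at h1
        refine le_trans (le_of_eq ?_) h1
        simp only [enorm_dilate_sq A hq0]
        have h2 := lintegral_comp_smul_space hρ0 fun y : Space d =>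
          ‖radialVec a y‖ₑ ^ 2 * (ENNReal.ofReal (r ^ d) * ‖u ((r / ρ) • y)‖ₑ ^ 2)
        simp only [smul_smul, div_mul_cancel₀ _ hρ0.ne'] at h2
        rw [h2, ← lintegral_const_mul' _ _ (by simp)]
        refine lintegral_congr fun y => ?_
        rw [mul_left_comm, ← mul_assoc (ENNReal.ofReal _) (ENNReal.ofReal _),
          ← ENNReal.ofReal_mul (by positivity), div_pow, div_eq_inv_mul (r ^ d)]
    _ = _ := by rw [setLIntegral_const, Real.volume_uIoc, mul_comm]

/-- A crude bound, uniform in `q`, whose only role is to make the supremum in the commutator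
estimate finite; its value drops out. -/
theorem fieldNorm_dilate_sq_le {r₀ : ℝ} {q : ℝ} (hr₀ : 1 ≤ r₀)
    (hq : q ∈ Set.Icc r₀⁻¹ r₀) {u : Space d → ℂ} {M R : ℝ} (hM : ∀ x, ‖u x‖ ≤ M)
    (hR : ∀ x, R ≤ ‖x‖ → u x = 0) :
    fieldNorm a (dilate A q u) ^ 2 ≤ ENNReal.ofReal (r₀ ^ d) * ENNReal.ofReal M ^ 2 *
      ∫⁻ x in Metric.ball 0 (r₀ * |R|), ‖radialVec a x‖ₑ ^ 2 := by
  have hq0 : 0 < q := (inv_pos.2 (by linarith)).trans_le hq.1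
  have hr0 : 0 < r₀ := by linarith
  rw [fieldNorm_sq, ← lintegral_const_mul' _ _ (by finiteness),
    ← lintegral_indicator Metric.isOpen_ball.measurableSet]
  refine lintegral_mono fun x => ?_
  rw [enorm_dilate_sq A hq0]
  by_cases hx : x ∈ Metric.ball (0 : Space d) (r₀ * |R|)
  · rw [Set.indicator_of_mem hx, mul_comm]
    gcongr
    · exact hq.2
    · rw [← ofReal_norm]
      exact ENNReal.ofReal_le_ofReal (hM _)
  · rw [mem_ball_zero_iff, not_lt] at hx
    have : u (q • x) = 0 := hR _ (by
      rw [norm_smul, Real.norm_of_nonneg hq0.le]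
      have h1 : r₀⁻¹ * (r₀ * |R|) ≤ q * ‖x‖ := mul_le_mul hq.1 hx (by positivity) hq0.le
      rw [inv_mul_cancel_left₀ hr0.ne'] at h1
      exact (le_abs_self R).trans h1)
    simp [this]

theorem eLpNorm_smul_dilate {r : ℝ} (hr : 0 < r) (G : Space d → EuclideanSpace ℂ (Fin d)) :
    eLpNorm (fun x => (r : ℂ) • dilate A r G x) 2 volume =
      ENNReal.ofReal r * eLpNorm G 2 volume := by
  rw [← eLpNorm_dilate (A := A) hr G]
  have h := eLpNorm_const_smul (p := 2) (μ := volume) (r : ℂ) (dilate A r G)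
  rw [← ofReal_norm, Complex.norm_real, Real.norm_of_nonneg hr.le] at h
  exact h

/-- The commutator estimate for bounded, compactly supported functions. -/
theorem eLpNorm_dilationError_le_of_small (hA : IsRegularPotential A a) {b : ℝ} (hb0 : 0 ≤ b)
    (hb1 : b < 1)
    (hb : ∀ u G, MemLp u 2 volume → MemLp G 2 volume → HasMagGrad A u G →
      fieldNorm a u ≤ ENNReal.ofReal b * eLpNorm G 2 volume)
    {u : Space d → ℂ} {G : Space d → EuclideanSpace ℂ (Fin d)} (hu : MemLp u 2 volume)
    (hum : Measurable u) (hG : MemLp G 2 volume) (h : HasMagGrad A u G) {M R : ℝ}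
    (hM : ∀ x, ‖u x‖ ≤ M) (hR : ∀ x, R ≤ ‖x‖ → u x = 0) {r₀ : ℝ} (hr₀ : 1 ≤ r₀) (hr₀' : r₀ ≤ 2)
    {r : ℝ} (hr : r ∈ Set.Icc r₀⁻¹ r₀) :
    eLpNorm (dilationError A a r u) 2 volume ≤ ENNReal.ofReal (|r - 1| *
      (b * r₀ * (eLpNorm G 2 volume).toReal / (1 - b * (r₀ - 1)))) := by
  set g := (eLpNorm G 2 volume).toReal with hg
  have hg' : eLpNorm G 2 volume = ENNReal.ofReal g := (ENNReal.ofReal_toReal hG.2.ne).symm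
  set σ := ⨆ q ∈ Set.Icc r₀⁻¹ r₀, fieldNorm a (dilate A q u) with hσ
  have hle : ∀ q ∈ Set.Icc r₀⁻¹ r₀, fieldNorm a (dilate A q u) ≤ σ := fun q hq =>
    le_iSup₂ (f := fun q (_ : q ∈ Set.Icc r₀⁻¹ r₀) => fieldNorm a (dilate A q u)) q hq
  -- This is where boundedness and compact support of `u` are essential: without finiteness `σ`
  -- could not be absorbed.
  have hfin : σ ≠ ⊤ := by
    set K := ENNReal.ofReal (r₀ ^ d) * ENNReal.ofReal M ^ 2 *
      ∫⁻ x in Metric.ball 0 (r₀ * |R|), ‖radialVec a x‖ₑ ^ 2 with hK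
    have hKt : K < ⊤ := ENNReal.mul_lt_top (by finiteness) (hA.lintegral_ball_radialVec_lt_top _)
    refine ne_top_of_le_ne_top (b := K ^ (1 / 2 : ℝ)) (by finiteness) (iSup₂_le fun q hq => ?_)
    have h1 := fieldNorm_dilate_sq_le (A := A) (a := a) hr₀ hq hM hR
    rw [← ENNReal.rpow_two] at h1
    have h2 := ENNReal.rpow_le_rpow h1 (z := 1 / 2) (by norm_num)
    rw [← ENNReal.rpow_mul] at h2
    norm_num at h2
    norm_num
    exact h2
  have herr : ∀ q ∈ Set.Icc r₀⁻¹ r₀, eLpNorm (dilationError A a q u) 2 volume ≤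
      ENNReal.ofReal |q - 1| * σ := fun q hq => eLpNorm_dilationError_le hA hr₀ hum hle hq
  -- Self-improvement: the smallness hypothesis for `D_q u` bounds `fieldNorm` by `∇_A D_q u`, whose
  -- commutator part is again controlled by `σ`, with a factor `r₀ - 1`.
  have hstep : σ ≤ ENNReal.ofReal b * (ENNReal.ofReal r₀ * ENNReal.ofReal g +
      ENNReal.ofReal (r₀ - 1) * σ) := by
    refine iSup₂_le fun q hq => ?_
    have hq0 : 0 < q := (inv_pos.2 (by linarith)).trans_le hq.1
    have hqabs : |q - 1| ≤ r₀ - 1 := by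
      rw [abs_le]
      refine ⟨?_, by linarith [hq.2]⟩
      -- `1/r₀` lies above its tangent line at `1`, so the left half of the interval is no longer
      -- than the right half.
      have h1 : 2 - r₀ ≤ r₀⁻¹ := by
        rw [← one_div, le_div_iff₀ (by linarith)]
        nlinarith [sq_nonneg (r₀ - 1)]
      linarith [hq.1]
    have hEm : MemLp (dilationError A a q u) 2 volume :=
      ⟨hA.aestronglyMeasurable_dilationError hq0 hu.1, (herr q hq).trans_lt (by finiteness)⟩
    have hDm : MemLp (fun x => (q : ℂ) • dilate A q G x) 2 volume :=
      (hA.memLp_dilate hq0 hG).const_smul (q : ℂ)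
    refine (hb _ _ (hA.memLp_dilate hq0 hu) (hDm.add hEm) (hA.hasMagGrad_dilate hq0 h hM)).trans ?_
    gcongr
    refine (eLpNorm_add_le hDm.1 hEm.1 (by norm_num)).trans (add_le_add ?_ ?_)
    · rw [eLpNorm_smul_dilate hq0, hg']
      gcongr
      exact hq.2
    · exact (herr q hq).trans (mul_le_mul_left (ENNReal.ofReal_le_ofReal hqabs) _)
  refine (herr r hr).trans ?_
  rw [ENNReal.ofReal_mul (abs_nonneg _)]
  gcongr
  rw [ENNReal.le_ofReal_iff_toReal_le hfin (by
    have : 0 ≤ 1 - b * (r₀ - 1) := by nlinarith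
    positivity)]
  have hs := ENNReal.toReal_mono (by finiteness) hstep
  rw [ENNReal.toReal_mul, ENNReal.toReal_add (by finiteness) (by finiteness), ENNReal.toReal_mul,
    ENNReal.toReal_mul, ENNReal.toReal_ofReal hb0, ENNReal.toReal_ofReal (by linarith),
    ENNReal.toReal_ofReal (by positivity), ENNReal.toReal_ofReal (by linarith)] at hs
  -- The denominator is positive because `b < 1` and `r₀ - 1 ≤ 1`.
  rw [le_div_iff₀ (by nlinarith)]
  nlinarith

end Estimate

/-! ### Truncation of the modulus. -/

section Truncation

/-- A smooth truncation of the modulus of a complex number. -/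
def truncate (ε : ℝ) (z : ℂ) : ℂ := ((1 + ε * ‖z‖ ^ 2)⁻¹ : ℝ) • z

/-- The derivative of the truncation. -/
def truncateDeriv (ε : ℝ) (z w : ℂ) : ℂ :=
  ((1 + ε * ‖z‖ ^ 2)⁻¹ : ℝ) • w -
    (2 * ε * ⟪z, w⟫_ℝ * ((1 + ε * ‖z‖ ^ 2) ^ 2)⁻¹ : ℝ) • z

theorem hasFDerivAt_inv_one_add_norm_sq {ε : ℝ} (hε : 0 ≤ ε) (z : ℂ) :
    HasFDerivAt (fun z : ℂ => (1 + ε * ‖z‖ ^ 2)⁻¹)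
      ((-((1 + ε * ‖z‖ ^ 2) ^ 2)⁻¹) • ε • (2 • innerSL ℝ z)) z := by
  have h0 : 1 + ε * ‖z‖ ^ 2 ≠ 0 := by positivity
  have h1 : HasFDerivAt (fun z : ℂ => 1 + ε * ‖z‖ ^ 2) (ε • (2 • innerSL ℝ z)) z :=
    ((hasStrictFDerivAt_norm_sq z).hasFDerivAt.const_mul ε).const_add 1
  exact (hasDerivAt_inv h0).comp_hasFDerivAt z h1

theorem contDiff_inv_one_add_norm_sq {ε : ℝ} (hε : 0 ≤ ε) :
    ContDiff ℝ 1 fun z : ℂ => (1 + ε * ‖z‖ ^ 2)⁻¹ :=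
  (contDiff_const.add (contDiff_const.mul (contDiff_norm_sq ℝ))).inv fun z => by positivity

/-- The product of a cut-off and the truncation. -/
def cutTruncate (ε : ℝ) (p : ℝ × ℂ) : ℂ := p.1 • truncate ε p.2

theorem contDiff_cutTruncate {ε : ℝ} (hε : 0 ≤ ε) : ContDiff ℝ 1 (cutTruncate ε) :=
  contDiff_fst.smul (((contDiff_inv_one_add_norm_sq hε).comp contDiff_snd).smul contDiff_snd)

theorem fderiv_cutTruncate {ε : ℝ} (hε : 0 ≤ ε) (p q : ℝ × ℂ) :
    fderiv ℝ (cutTruncate ε) p q = q.1 • truncate ε p.2 + p.1 • truncateDeriv ε p.2 q.2 := by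
  have h1 := (hasFDerivAt_inv_one_add_norm_sq hε p.2).smul (hasFDerivAt_id p.2)
  have h2 := (hasFDerivAt_fst (𝕜 := ℝ) (p := p)).smul (h1.comp p hasFDerivAt_snd)
  have h3 : fderiv ℝ (cutTruncate ε) p = _ := h2.fderiv
  rw [h3]
  simp [truncate, truncateDeriv]
  ring

theorem norm_truncate_le {ε : ℝ} (hε : 0 ≤ ε) (z : ℂ) : ‖truncate ε z‖ ≤ ‖z‖ := by
  have h : 0 < 1 + ε * ‖z‖ ^ 2 := by positivity
  rw [truncate, norm_smul, Real.norm_of_nonneg (by positivity)]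
  refine mul_le_of_le_one_left (norm_nonneg _) (inv_le_one_of_one_le₀ ?_)
  nlinarith [sq_nonneg ‖z‖]

theorem norm_truncate_le_inv {ε : ℝ} (hε : 0 < ε) (hε1 : ε ≤ 1) (z : ℂ) :
    ‖truncate ε z‖ ≤ ε⁻¹ := by
  have h : 0 < 1 + ε * ‖z‖ ^ 2 := by positivity
  rw [truncate, norm_smul, Real.norm_of_nonneg (by positivity), inv_mul_le_iff₀ h,
    ← div_eq_mul_inv, le_div_iff₀ hε]
  nlinarith [sq_nonneg (‖z‖ - 1), norm_nonneg z, mul_nonneg hε.le (sq_nonneg (‖z‖ - 1))]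

/-- The two terms contribute `1` and `2`. The constant does not depend on `ε` or `z`, which is what
dominated convergence needs as `ε → 0`. -/
theorem norm_truncateDeriv_le {ε : ℝ} (hε : 0 ≤ ε) (z w : ℂ) :
    ‖truncateDeriv ε z w‖ ≤ 3 * ‖w‖ := by
  set D := 1 + ε * ‖z‖ ^ 2 with hD
  have hD1 : 1 ≤ D := by rw [hD]; nlinarith [mul_nonneg hε (sq_nonneg ‖z‖)]
  have hD0 : 0 < D := by linarith
  refine (norm_sub_le _ _).trans ?_
  rw [norm_smul, norm_smul, Real.norm_of_nonneg (by positivity), norm_mul, norm_mul,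
    Real.norm_of_nonneg (by positivity : 0 ≤ 2 * ε),
    Real.norm_of_nonneg (by positivity : 0 ≤ (D ^ 2)⁻¹)]
  have h1 : D⁻¹ * ‖w‖ ≤ 1 * ‖w‖ :=
    mul_le_mul_of_nonneg_right (inv_le_one_of_one_le₀ hD1) (norm_nonneg _)
  have h2 : 2 * ε * ‖⟪z, w⟫_ℝ‖ * (D ^ 2)⁻¹ * ‖z‖ ≤ 2 * ‖w‖ := by
    calc _ ≤ 2 * ε * (‖z‖ * ‖w‖) * (D ^ 2)⁻¹ * ‖z‖ := by
          gcongr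
          exact norm_inner_le_norm z w
      _ = 2 * ‖w‖ * ((ε * ‖z‖ ^ 2) * (D ^ 2)⁻¹) := by ring
      _ ≤ 2 * ‖w‖ * 1 := by
          gcongr
          rw [← div_eq_mul_inv, div_le_one (by positivity)]
          nlinarith
      _ = _ := mul_one _
  linarith

/-- The gauge term rotates `z` and does not move its modulus, so functions of `|ψ|` do not feel `A`.
-/
theorem real_inner_I_mul (s : ℝ) (z : ℂ) : ⟪z, Complex.I * (s : ℂ) * z⟫_ℝ = 0 := by
  rw [Complex.inner]
  simp
  ring

/-- The truncation multiplies `z` by a function of `|z|`, so it is gauge covariant: the term `i A ψ`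
comes out as `i A` times the truncation, and `∇_A` of a truncation involves only `∇_A ψ`. -/
theorem truncateDeriv_add_gauge (ε s : ℝ) (z w : ℂ) :
    truncateDeriv ε z (w + Complex.I * (s : ℂ) * z) =
      truncateDeriv ε z w + Complex.I * (s : ℂ) * truncate ε z := by
  simp only [truncateDeriv, truncate, inner_add_right, real_inner_I_mul, add_zero, smul_add,
    mul_smul_comm]
  ring

theorem continuousAt_inv_one_add_mul (z : ℂ) :
    ContinuousAt (fun ε : ℝ => (1 + ε * ‖z‖ ^ 2)⁻¹) 0 :=
  ContinuousAt.inv₀ (f := fun ε : ℝ => 1 + ε * ‖z‖ ^ 2) (by fun_prop) (by simp)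

theorem tendsto_truncate (z : ℂ) : Tendsto (fun ε => truncate ε z) (𝓝 0) (𝓝 z) := by
  have h : Tendsto (fun ε => truncate ε z) (𝓝 0) (𝓝 (((1 + 0 * ‖z‖ ^ 2)⁻¹ : ℝ) • z)) :=
    (continuousAt_inv_one_add_mul z).tendsto.smul tendsto_const_nhds
  simpa only [zero_mul, add_zero, inv_one, one_smul] using h

theorem tendsto_truncateDeriv (z w : ℂ) :
    Tendsto (fun ε => truncateDeriv ε z w) (𝓝 0) (𝓝 w) := by
  have h1 := (continuousAt_inv_one_add_mul z).tendsto
  have h2 : Tendsto (fun ε : ℝ => 2 * ε * ⟪z, w⟫_ℝ) (𝓝 0) (𝓝 (2 * 0 * ⟪z, w⟫_ℝ)) :=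
    ((continuous_const.mul continuous_id).mul continuous_const).tendsto 0
  have h3 := (h1.smul_const w).sub ((h2.mul (h1.pow 2)).smul_const z)
  simp only [zero_mul, mul_zero, add_zero, inv_one, one_smul, zero_smul, sub_zero] at h3
  refine h3.congr fun ε => ?_
  rw [truncateDeriv, inv_pow]

end Truncation

/-! ### Density of bounded, compactly supported functions in the graph norm. -/

section Density

variable {d : ℕ}

theorem tendsto_eLpNorm_sub_of_dominated {E : Type*} [NormedAddCommGroup E]
    {f : ℕ → Space d → E} {f₀ : Space d → E} {g : Space d → ℝ} (hg : MemLp g 2 volume)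
    (hf : ∀ n, AEStronglyMeasurable (f n) volume) (hf₀ : AEStronglyMeasurable f₀ volume)
    (hle : ∀ n x, ‖f n x - f₀ x‖ ≤ g x)
    (hlim : ∀ᵐ x, Tendsto (fun n => f n x) atTop (𝓝 (f₀ x))) :
    Tendsto (fun n => eLpNorm (fun x => f n x - f₀ x) 2 volume) atTop (𝓝 0) := by
  have h1 : Tendsto (fun n => ∫⁻ x, ‖f n x - f₀ x‖ₑ ^ 2) atTop (𝓝 (∫⁻ _ : Space d, 0)) := by
    refine tendsto_lintegral_of_dominated_convergence' (fun x => ‖g x‖ₑ ^ 2)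
      (fun n => ((hf n).sub hf₀).enorm.pow_const 2)
      (fun n => Eventually.of_forall fun x => ?_) ?_ (hlim.mono fun x hx => ?_)
    · simp only
      gcongr
      rw [← ofReal_norm, ← ofReal_norm]
      exact ENNReal.ofReal_le_ofReal ((hle n x).trans (Real.le_norm_self _))
    · rw [← eLpNorm_two_sq]
      exact (ENNReal.pow_lt_top hg.2).ne
    · have := ENNReal.Tendsto.pow (n := 2) (hx.sub_const (f₀ x)).enorm
      simpa using this
  rw [lintegral_zero] at h1
  simp only [← eLpNorm_two_sq] at h1
  have h2 := (ENNReal.continuous_rpow_const (y := 1 / 2)).tendsto 0 |>.comp h1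
  refine (h2.congr fun n => ?_).trans (by simp)
  simp only [Function.comp]
  rw [← ENNReal.rpow_two, ← ENNReal.rpow_mul]
  norm_num

/-- A cut-off function at scale one. -/
def cutoff (d : ℕ) : ContDiffBump (0 : Space d) where
  rIn := 1
  rOut := 2
  rIn_pos := one_pos
  rIn_lt_rOut := one_lt_two

/-- The cut-off truncation of a function. -/
def approx (n : ℕ) (ψ : Space d → ℂ) (x : Space d) : ℂ :=
  cutTruncate ((n : ℝ) + 1)⁻¹ (cutoff d (((n : ℝ) + 1)⁻¹ • x), ψ x)

/-- The magnetic gradient of the cut-off truncation of a function. -/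
def approxGrad (n : ℕ) (ψ : Space d → ℂ) (G : Space d → EuclideanSpace ℂ (Fin d)) (x : Space d) :
    EuclideanSpace ℂ (Fin d) :=
  WithLp.toLp 2 fun j =>
    (((n : ℝ) + 1)⁻¹ * fderiv ℝ (cutoff d) (((n : ℝ) + 1)⁻¹ • x) (EuclideanSpace.single j 1)) •
      truncate ((n : ℝ) + 1)⁻¹ (ψ x) +
    cutoff d (((n : ℝ) + 1)⁻¹ • x) • truncateDeriv ((n : ℝ) + 1)⁻¹ (ψ x) (G x j)

theorem eps_pos (n : ℕ) : 0 < ((n : ℝ) + 1)⁻¹ := by positivity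

theorem eps_le_one (n : ℕ) : ((n : ℝ) + 1)⁻¹ ≤ 1 :=
  inv_le_one_of_one_le₀ (by linarith [(n.cast_nonneg : (0 : ℝ) ≤ n)])

theorem tendsto_eps : Tendsto (fun n : ℕ => ((n : ℝ) + 1)⁻¹) atTop (𝓝 0) := by
  simpa using tendsto_one_div_add_atTop_nhds_zero_nat (𝕜 := ℝ)

theorem abs_cutoff_le (x : Space d) : |cutoff d x| ≤ 1 := by
  rw [abs_of_nonneg (cutoff d).nonneg]
  exact (cutoff d).le_one

theorem norm_approx_le (n : ℕ) (ψ : Space d → ℂ) (x : Space d) : ‖approx n ψ x‖ ≤ ‖ψ x‖ := by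
  rw [approx, cutTruncate, norm_smul, Real.norm_eq_abs]
  exact (mul_le_of_le_one_left (norm_nonneg _) (abs_cutoff_le _)).trans
    (norm_truncate_le (eps_pos n).le _)

theorem norm_approx_le_nat (n : ℕ) (ψ : Space d → ℂ) (x : Space d) :
    ‖approx n ψ x‖ ≤ (n : ℝ) + 1 := by
  rw [approx, cutTruncate, norm_smul, Real.norm_eq_abs]
  refine (mul_le_of_le_one_left (norm_nonneg _) (abs_cutoff_le _)).trans ?_
  simpa using norm_truncate_le_inv (eps_pos n) (eps_le_one n) (ψ x)

theorem approx_eq_zero (n : ℕ) (ψ : Space d → ℂ) (x : Space d) (hx : 2 * ((n : ℝ) + 1) ≤ ‖x‖) :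
    approx n ψ x = 0 := by
  have : cutoff d (((n : ℝ) + 1)⁻¹ • x) = 0 := by
    refine (cutoff d).zero_of_le_dist ?_
    rw [dist_zero_right, norm_smul, Real.norm_of_nonneg (eps_pos n).le, inv_mul_eq_div,
      le_div_iff₀ (by positivity)]
    exact hx
  rw [approx, cutTruncate, this, zero_smul]

theorem contDiff_cutoff_smul (n : ℕ) :
    ContDiff ℝ 1 fun x : Space d => cutoff d (((n : ℝ) + 1)⁻¹ • x) :=
  (cutoff d).contDiff.comp (contDiff_const_smul _)

theorem measurable_approx (n : ℕ) {ψ : Space d → ℂ} (hψ : Measurable ψ) :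
    Measurable (approx n ψ) :=
  (contDiff_cutTruncate (eps_pos n).le).continuous.measurable.comp
    ((contDiff_cutoff_smul n).continuous.measurable.prodMk hψ)

/-- The chain rule for the pair (cut-off, `ψ`) on the slab where the cut-off is at most `1`. There
the derivative is bounded by `(n + 1) + 3`: the truncation is at most `ε⁻¹ = n + 1`, its derivative
at most `3`. -/
theorem hasMagGrad_approx (n : ℕ) {A : Space d → Space d} {ψ : Space d → ℂ}
    {G : Space d → EuclideanSpace ℂ (Fin d)} (h : HasMagGrad A ψ G) :
    HasMagGrad A (approx n ψ) (approxGrad n ψ G) := by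
  intro j
  have hε := (eps_pos n).le
  have h1 := (hasWeakPartialDeriv_of_contDiff (contDiff_cutoff_smul n) j).prodMk (h j)
  have hC : Convex ℝ {p : ℝ × ℂ | |p.1| ≤ 1} := by
    have : {p : ℝ × ℂ | |p.1| ≤ 1} = Prod.fst ⁻¹' (Metric.closedBall (0 : ℝ) 1) := by ext; simp
    rw [this]
    exact (convex_closedBall (0 : ℝ) 1).linear_preimage (LinearMap.fst ℝ ℝ ℂ)
  have hC' : IsClosed {p : ℝ × ℂ | |p.1| ≤ 1} := isClosed_le continuous_fst.abs continuous_const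
  have hK : ∀ z ∈ {p : ℝ × ℂ | |p.1| ≤ 1},
      ‖fderiv ℝ (cutTruncate ((n : ℝ) + 1)⁻¹) z‖ ≤ ((n : ℝ) + 1) + 3 := fun z hz => by
    refine ContinuousLinearMap.opNorm_le_bound _ (by positivity) fun q => ?_
    rw [fderiv_cutTruncate hε]
    refine (norm_add_le _ _).trans ?_
    rw [norm_smul, norm_smul, add_mul, mul_comm]
    refine add_le_add (mul_le_mul ?_ (norm_fst_le q) (norm_nonneg _) (by positivity)) ?_
    · simpa using norm_truncate_le_inv (eps_pos n) (eps_le_one n) z.2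
    · refine (mul_le_of_le_one_left (norm_nonneg _) hz).trans
        ((norm_truncateDeriv_le hε _ _).trans ?_)
      gcongr
      exact norm_snd_le q
  have h2 := h1.comp (contDiff_cutTruncate hε) hC hC' (fun x => abs_cutoff_le _) hK
  refine h2.congr_ae EventuallyEq.rfl (Eventually.of_forall fun x => ?_)
  have h3 : fderiv ℝ (fun x : Space d => cutoff d (((n : ℝ) + 1)⁻¹ • x)) x =
      ((n : ℝ) + 1)⁻¹ • fderiv ℝ (cutoff d) (((n : ℝ) + 1)⁻¹ • x) := fderiv_comp_smul ..
  simp only [fderiv_cutTruncate hε, h3, smul_apply, truncateDeriv_add_gauge, approxGrad,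
    approx, cutTruncate, smul_add, smul_eq_mul, mul_smul_comm]
  ring

theorem tendsto_cutoff (x : Space d) :
    Tendsto (fun n : ℕ => cutoff d (((n : ℝ) + 1)⁻¹ • x)) atTop (𝓝 1) := by
  have h1 : Tendsto (fun n : ℕ => ((n : ℝ) + 1)⁻¹ • x) atTop (𝓝 0) := by
    simpa using tendsto_eps.smul_const x
  have h2 := ((cutoff d).continuous.tendsto 0).comp h1
  rwa [(cutoff d).one_of_mem_closedBall (by simp [(cutoff d).rIn_pos.le])] at h2

theorem tendsto_approx (ψ : Space d → ℂ) (x : Space d) :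
    Tendsto (fun n => approx n ψ x) atTop (𝓝 (ψ x)) := by
  have := (tendsto_cutoff x).smul ((tendsto_truncate (ψ x)).comp tendsto_eps)
  simpa [approx, cutTruncate] using this

theorem exists_bound_fderiv_cutoff (d : ℕ) : ∃ C, 0 ≤ C ∧ ∀ (j : Fin d) (x : Space d),
    |fderiv ℝ (cutoff d) x (EuclideanSpace.single j 1)| ≤ C := by
  have hc : ContDiff ℝ ∞ (cutoff d) := (cutoff d).contDiff
  obtain ⟨C, hC⟩ := ((cutoff d).hasCompactSupport.fderiv ℝ).exists_bound_of_continuous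
    (hc.continuous_fderiv (by simp))
  refine ⟨C, (norm_nonneg _).trans (hC 0), fun j x => ?_⟩
  have := (fderiv ℝ (cutoff d) x).le_of_opNorm_le (hC x) (EuclideanSpace.single j 1)
  simpa using this

theorem tendsto_approxGrad (ψ : Space d → ℂ) (G : Space d → EuclideanSpace ℂ (Fin d))
    (x : Space d) : Tendsto (fun n => approxGrad n ψ G x) atTop (𝓝 (G x)) := by
  obtain ⟨C, hC0, hC⟩ := exists_bound_fderiv_cutoff d
  refine ((PiLp.continuous_toLp 2 _).tendsto (fun j => G x j)).comp
    (tendsto_pi_nhds.2 fun j => ?_)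
  have h0 : Tendsto (fun n : ℕ => ((n : ℝ) + 1)⁻¹ *
      fderiv ℝ (cutoff d) (((n : ℝ) + 1)⁻¹ • x) (EuclideanSpace.single j 1)) atTop (𝓝 0) := by
    refine squeeze_zero_norm (fun n => ?_) (by simpa using tendsto_eps.mul_const C)
    rw [norm_mul, Real.norm_of_nonneg (eps_pos n).le]
    exact mul_le_mul_of_nonneg_left (hC j _) (eps_pos n).le
  have h1 := h0.smul ((tendsto_truncate (ψ x)).comp tendsto_eps)
  have h2 := (tendsto_cutoff x).smul ((tendsto_truncateDeriv (ψ x) (G x j)).comp tendsto_eps)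
  have h3 := h1.add h2
  rw [zero_smul, one_smul, zero_add] at h3
  exact h3

theorem norm_le_sum_norm_apply (v : EuclideanSpace ℂ (Fin d)) : ‖v‖ ≤ ∑ j, ‖v j‖ := by
  have h : v = ∑ j, EuclideanSpace.single j (v j) := by
    ext k
    simp [Finset.sum_apply, Pi.single_apply]
  calc ‖v‖ = ‖∑ j, EuclideanSpace.single j (v j)‖ := by rw [← h]
    _ ≤ ∑ j, ‖EuclideanSpace.single j (v j)‖ := norm_sum_le _ _
    _ = _ := by simp

/-- The bound on `approx` itself grows with `n`, but this pointwise bound on the gradient is uniform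
in `n` and serves as the dominating function. -/
theorem exists_norm_approxGrad_le (d : ℕ) : ∃ C : ℝ, ∀ (n : ℕ) (ψ : Space d → ℂ)
    (G : Space d → EuclideanSpace ℂ (Fin d)) (x : Space d),
    ‖approxGrad n ψ G x‖ ≤ C * ‖ψ x‖ + C * ‖G x‖ := by
  obtain ⟨C, hC0, hC⟩ := exists_bound_fderiv_cutoff d
  refine ⟨d * (C + 3), fun n ψ G x => (norm_le_sum_norm_apply _).trans ?_⟩
  have h1 : ∀ j ∈ Finset.univ, ‖approxGrad n ψ G x j‖ ≤ (C + 3) * ‖ψ x‖ + (C + 3) * ‖G x‖ := by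
    intro j _
    simp only [approxGrad]
    refine (norm_add_le _ _).trans (add_le_add ?_ ?_)
    · rw [norm_smul, norm_mul, Real.norm_of_nonneg (eps_pos n).le]
      refine mul_le_mul ?_ (norm_truncate_le (eps_pos n).le _) (norm_nonneg _) (by positivity)
      refine (mul_le_of_le_one_left (norm_nonneg _) (eps_le_one n)).trans ?_
      exact (hC j _).trans (by linarith)
    · rw [norm_smul]
      refine (mul_le_of_le_one_left (norm_nonneg _) (abs_cutoff_le _)).trans
        ((norm_truncateDeriv_le (eps_pos n).le _ _).trans ?_)
      exact mul_le_mul (by linarith) (PiLp.norm_apply_le _ _) (norm_nonneg _) (by positivity)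
  refine (Finset.sum_le_card_nsmul _ _ _ h1).trans (le_of_eq ?_)
  rw [Finset.card_univ, Fintype.card_fin, nsmul_eq_mul]
  ring

theorem measurable_approxGrad (n : ℕ) {ψ : Space d → ℂ} (hψ : Measurable ψ)
    {G : Space d → EuclideanSpace ℂ (Fin d)} (hG : Measurable G) :
    Measurable (approxGrad n ψ G) := by
  refine (PiLp.continuous_toLp 2 _).measurable.comp (measurable_pi_iff.2 fun j => ?_)
  have h1 : Measurable fun x : Space d =>
      fderiv ℝ (cutoff d) (((n : ℝ) + 1)⁻¹ • x) (EuclideanSpace.single j 1) :=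
    ((continuous_partial (cutoff d).contDiff j).comp (continuous_const_smul _)).measurable
  have h2 : Measurable fun x : Space d => cutoff d (((n : ℝ) + 1)⁻¹ • x) :=
    (contDiff_cutoff_smul n).continuous.measurable
  have h3 : Measurable fun x => G x j :=
    (EuclideanSpace.proj (𝕜 := ℂ) j).continuous.measurable.comp hG
  have h4 : Measurable fun x => ⟪ψ x, G x j⟫_ℝ := hψ.inner h3
  unfold truncate truncateDeriv
  fun_prop

theorem memLp_approx (n : ℕ) {ψ : Space d → ℂ} (hψm : Measurable ψ) (hψ : MemLp ψ 2 volume) :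
    MemLp (approx n ψ) 2 volume :=
  hψ.of_le (measurable_approx n hψm).aestronglyMeasurable
    (Eventually.of_forall (norm_approx_le n ψ))

theorem memLp_approxGrad (n : ℕ) {ψ : Space d → ℂ} (hψm : Measurable ψ) (hψ : MemLp ψ 2 volume)
    {G : Space d → EuclideanSpace ℂ (Fin d)} (hGm : Measurable G) (hG : MemLp G 2 volume) :
    MemLp (approxGrad n ψ G) 2 volume := by
  obtain ⟨C, hC⟩ := exists_norm_approxGrad_le d
  refine ((hψ.norm.const_mul C).add (hG.norm.const_mul C)).of_le
    (measurable_approxGrad n hψm hGm).aestronglyMeasurable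
    (Eventually.of_forall fun x => (hC n ψ G x).trans (Real.le_norm_self _))

theorem tendsto_eLpNorm_approx {ψ : Space d → ℂ} (hψm : Measurable ψ) (hψ : MemLp ψ 2 volume) :
    Tendsto (fun n => eLpNorm (fun x => approx n ψ x - ψ x) 2 volume) atTop (𝓝 0) := by
  refine tendsto_eLpNorm_sub_of_dominated (hψ.norm.const_mul 2)
    (fun n => (measurable_approx n hψm).aestronglyMeasurable) hψ.1 (fun n x => ?_)
    (Eventually.of_forall (tendsto_approx ψ))
  refine (norm_sub_le _ _).trans ?_
  linarith [norm_approx_le n ψ x]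

theorem tendsto_eLpNorm_approxGrad {ψ : Space d → ℂ} (hψm : Measurable ψ)
    (hψ : MemLp ψ 2 volume) {G : Space d → EuclideanSpace ℂ (Fin d)} (hGm : Measurable G)
    (hG : MemLp G 2 volume) :
    Tendsto (fun n => eLpNorm (fun x => approxGrad n ψ G x - G x) 2 volume) atTop (𝓝 0) := by
  obtain ⟨C, hC⟩ := exists_norm_approxGrad_le d
  refine tendsto_eLpNorm_sub_of_dominated
    (((hψ.norm.const_mul C).add (hG.norm.const_mul C)).add hG.norm)
    (fun n => (measurable_approxGrad n hψm hGm).aestronglyMeasurable) hG.1 (fun n x => ?_)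
    (Eventually.of_forall (tendsto_approxGrad ψ G))
  exact (norm_sub_le _ _).trans (add_le_add (hC n ψ G x) le_rfl)

end Density

/-! ### Vanishing magnetic gradient. -/

section ZeroGradient

variable {d : ℕ}

/-- The mollifications have zero gradient, hence are constant; they are also integrable, and the
whole space has infinite measure since `d ≥ 1`, so the constants are zero. -/
theorem ae_eq_zero_of_weakPartialDeriv_zero (hd : 1 ≤ d) {h : Space d → ℝ}
    (hi : Integrable h volume) (h0 : ∀ j : Fin d, HasWeakPartialDeriv j h fun _ => 0) :
    h =ᵐ[volume] 0 := by
  have : Nonempty (Fin d) := ⟨⟨0, hd⟩⟩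
  have : NoncompactSpace (Space d) := NormedSpace.noncompactSpace ℝ _
  have hz : ∀ n x, mollify n h x = 0 := fun n => by
    have hc := contDiff_mollify n hi.locallyIntegrable
    have hf : ∀ x, fderiv ℝ (mollify n h) x = 0 := fun x => by
      refine ContinuousLinearMap.ext_on (s := Set.range (EuclideanSpace.basisFun (Fin d) ℝ)) ?_ ?_
      · rw [← OrthonormalBasis.coe_toBasis, Module.Basis.span_eq]
        exact dense_univ
      · rintro _ ⟨j, rfl⟩
        rw [EuclideanSpace.basisFun_apply, fderiv_mollify (h0 j), mollify_apply]
        simp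
    have hconst := is_const_of_fderiv_eq_zero (hc.differentiable one_ne_zero) hf
    have hint : Integrable (mollify n h) volume :=
      (bump d n).integrable_normed.integrable_convolution _ hi
    have he : mollify n h = fun _ => mollify n h 0 := funext fun x => hconst x 0
    rw [he, integrable_const_iff] at hint
    rcases hint with h1 | h1
    · exact fun x => (hconst x 0).trans h1
    · have h2 := h1.measure_univ_lt_top
      rw [measure_univ_of_isAddLeftInvariant] at h2
      exact absurd h2 (lt_irrefl _)
  filter_upwards [ae_tendsto_mollify hi.locallyIntegrable] with x hx
  simp only [hz] at hx
  exact tendsto_nhds_unique hx tendsto_const_nhds |>.trans rfl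

/-- A square integrable function with vanishing magnetic gradient vanishes. -/
theorem HasMagGrad.ae_eq_zero (hd : 1 ≤ d) {A : Space d → Space d} {ψ : Space d → ℂ}
    {G : Space d → EuclideanSpace ℂ (Fin d)} (hψ : MemLp ψ 2 volume) (h : HasMagGrad A ψ G)
    (hG : G =ᵐ[volume] 0) : ψ =ᵐ[volume] 0 := by
  -- `T(z) = |z|² / (1 + |z|²)` depends on the modulus alone, has bounded derivative, vanishes only
  -- at `0`, and is at most `|z|²`, so `T ∘ ψ` is integrable.
  set T : ℂ → ℝ := fun z => 1 - (1 + 1 * ‖z‖ ^ 2)⁻¹ with hT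
  have hTc : ContDiff ℝ 1 T := contDiff_const.sub (contDiff_inv_one_add_norm_sq zero_le_one)
  have hTd : ∀ z w, fderiv ℝ T z w = ((1 + ‖z‖ ^ 2) ^ 2)⁻¹ * (2 * ⟪z, w⟫_ℝ) := fun z w => by
    have h1 := ((hasFDerivAt_inv_one_add_norm_sq zero_le_one z).const_sub 1).fderiv
    rw [h1]
    simp only [one_mul, neg_apply, smul_apply, innerSL_apply_apply, smul_eq_mul, nsmul_eq_mul,
      one_smul]
    ring
  have hT0 : ∀ z, 0 ≤ T z ∧ T z ≤ ‖z‖ ^ 2 ∧ (T z = 0 → z = 0) := fun z => by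
    have hp : 0 < 1 + ‖z‖ ^ 2 := by positivity
    have e : T z = ‖z‖ ^ 2 / (1 + ‖z‖ ^ 2) := by
      simp only [hT, one_mul]
      field_simp
      ring
    refine ⟨by rw [e]; positivity, ?_, fun hz => ?_⟩
    · rw [e]
      exact div_le_self (by positivity) (by nlinarith [sq_nonneg ‖z‖])
    · rw [e, div_eq_zero_iff] at hz
      rcases hz with hz | hz
      · simpa using hz
      · exact absurd hz hp.ne'
  have hK : ∀ z ∈ (Set.univ : Set ℂ), ‖fderiv ℝ T z‖ ≤ 1 := fun z _ => by
    refine ContinuousLinearMap.opNorm_le_bound _ zero_le_one fun w => ?_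
    rw [hTd, norm_mul, norm_mul, Real.norm_of_nonneg (by positivity), Real.norm_two,
      inv_mul_le_iff₀ (by positivity), one_mul]
    have h1 := norm_inner_le_norm (𝕜 := ℝ) z w
    have h2 : 2 * ‖z‖ ≤ (1 + ‖z‖ ^ 2) ^ 2 := by
      nlinarith [sq_nonneg (‖z‖ - 1), sq_nonneg ‖z‖, sq_nonneg (‖z‖ ^ 2)]
    nlinarith [norm_nonneg w]
  have hw : ∀ j : Fin d, HasWeakPartialDeriv j (fun x => T (ψ x)) fun _ => 0 := fun j => by
    refine ((h j).comp hTc convex_univ isClosed_univ (fun _ => Set.mem_univ _) hK).congr_ae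
      EventuallyEq.rfl ?_
    filter_upwards [hG] with x hx
    rw [hTd, hx, Pi.zero_apply, PiLp.zero_apply, zero_add, real_inner_I_mul, mul_zero, mul_zero]
  have hi : Integrable (fun x => T (ψ x)) volume := by
    refine hψ.norm.integrable_sq.mono' (hTc.continuous.comp_aestronglyMeasurable hψ.1)
      (Eventually.of_forall fun x => ?_)
    rw [Real.norm_of_nonneg (hT0 _).1]
    exact (hT0 _).2.1
  filter_upwards [ae_eq_zero_of_weakPartialDeriv_zero hd hi hw] with x hx
  exact (hT0 _).2.2 hx

end ZeroGradient

/-! ### Dilations as isometries of `L²`. -/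

section DilationLp

variable {d : ℕ} {E : Type*} [NormedAddCommGroup E] [InnerProductSpace ℂ E]
  {A : Space d → Space d} {a : Fin d → Fin d → Space d → ℝ}

open Classical in
/-- The magnetic dilation on `L²`. -/
def dilateLp (A : Space d → Space d) (r : ℝ) (f : Lp E 2 (volume : Measure (Space d))) :
    Lp E 2 (volume : Measure (Space d)) :=
  -- For a regular potential and `r > 0` the value `0` is never a default:
  -- `IsRegularPotential.memLp_dilate` always supplies the first branch.
  if h : MemLp (dilate A r f) 2 volume then h.toLp _ else 0

theorem IsRegularPotential.coeFn_dilateLp (hA : IsRegularPotential A a) {r : ℝ} (hr : 0 < r)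
    (f : Lp E 2 (volume : Measure (Space d))) : dilateLp A r f =ᵐ[volume] dilate A r f := by
  have h := hA.memLp_dilate hr (Lp.memLp f)
  rw [dilateLp, dif_pos h]
  exact h.coeFn_toLp

theorem dilate_congr_ae {r : ℝ} (hr : 0 < r) {f g : Space d → E} (h : f =ᵐ[volume] g) :
    dilate A r f =ᵐ[volume] dilate A r g := by
  filter_upwards [(quasiMeasurePreserving_smul hr.ne').ae_eq_comp h] with x hx
  rw [dilate, dilate]
  exact congrArg _ hx

theorem IsRegularPotential.dilateLp_toLp (hA : IsRegularPotential A a) {r : ℝ} (hr : 0 < r)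
    {f : Space d → E} (hf : MemLp f 2 volume) :
    dilateLp A r (hf.toLp f) = (hA.memLp_dilate hr hf).toLp _ := by
  refine Lp.ext ?_
  exact ((hA.coeFn_dilateLp hr _).trans (dilate_congr_ae hr hf.coeFn_toLp)).trans
    (MemLp.coeFn_toLp _).symm

theorem IsRegularPotential.norm_dilateLp_sub (hA : IsRegularPotential A a) {r : ℝ} (hr : 0 < r)
    (f g : Lp E 2 (volume : Measure (Space d))) :
    ‖dilateLp A r f - dilateLp A r g‖ = ‖f - g‖ := by
  rw [Lp.norm_def, Lp.norm_def, ← eLpNorm_dilate (A := A) hr (f - g : Lp E 2 volume)]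
  congr 1
  refine eLpNorm_congr_ae ?_
  filter_upwards [Lp.coeFn_sub (dilateLp A r f) (dilateLp A r g), hA.coeFn_dilateLp hr f,
    hA.coeFn_dilateLp hr g, dilate_congr_ae (A := A) hr (Lp.coeFn_sub f g)] with x h1 h2 h3 h4
  rw [h1, h4, Pi.sub_apply, h2, h3]
  simp only [dilate, Pi.sub_apply, smul_sub]

/-- The substitution `y = r x`: the phases match by `gaugePhase_inv_smul` and the Jacobian `r^d`
turns the weight `r^(-d/2)` into `r^(d/2)`. -/
theorem IsRegularPotential.inner_dilateLp (hA : IsRegularPotential A a) {r : ℝ} (hr : 0 < r)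
    (f g : Lp E 2 (volume : Measure (Space d))) :
    ⟪dilateLp A r f, g⟫_ℂ = ⟪f, dilateLp A r⁻¹ g⟫_ℂ := by
  have hri := inv_pos.2 hr
  rw [L2.inner_def, L2.inner_def]
  have e1 : ∫ x, ⟪dilateLp A r f x, g x⟫_ℂ = ∫ x, ⟪dilate A r f x, g x⟫_ℂ :=
    integral_congr_ae ((hA.coeFn_dilateLp hr f).mono fun x hx => by simp only [hx])
  have e2 : ∫ x, ⟪f x, dilateLp A r⁻¹ g x⟫_ℂ = ∫ x, ⟪f x, dilate A r⁻¹ g x⟫_ℂ :=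
    integral_congr_ae ((hA.coeFn_dilateLp hri g).mono fun x hx => by simp only [hx])
  rw [e1, e2]
  have e3 := Measure.integral_comp_smul_of_nonneg volume
    (fun y : Space d => ⟪f y, dilate A r⁻¹ g y⟫_ℂ) r (hR := hr.le)
  rw [eq_inv_smul_iff₀ (by positivity), finrank_euclideanSpace_fin] at e3
  rw [← e3, ← integral_smul]
  refine integral_congr_ae (Eventually.of_forall fun x => ?_)
  simp only [dilate, inner_smul_left, inner_smul_right, gaugePhase_inv_smul A hr.ne',
    inv_smul_smul₀ hr.ne', map_mul, Complex.conj_ofReal, ← Complex.exp_conj, map_neg,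
    Complex.conj_I, Complex.real_smul, Complex.ofReal_neg, mul_neg, neg_mul, neg_neg]
  have hs : ((r ^ d : ℝ) : ℂ) * (√(r⁻¹ ^ d) : ℂ) = (√(r ^ d) : ℂ) := by
    rw [← Complex.ofReal_mul, inv_pow, Real.sqrt_inv, ← div_eq_mul_inv, Real.div_sqrt]
  rw [← hs]
  ring

theorem IsRegularPotential.re_inner_dilateLp_inv (hA : IsRegularPotential A a) {r : ℝ}
    (hr : 0 < r) (f : Lp E 2 (volume : Measure (Space d))) :
    (⟪dilateLp A r⁻¹ f, f⟫_ℂ).re = (⟪dilateLp A r f, f⟫_ℂ).re := by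
  rw [hA.inner_dilateLp hr, ← inner_conj_symm, Complex.conj_re]

/-- A sequence of dilation parameters decreasing to one. -/
def dilationParam (n : ℕ) : ℝ := 1 + ((n : ℝ) + 1)⁻¹

theorem one_lt_dilationParam (n : ℕ) : 1 < dilationParam n := by
  linarith [eps_pos n, dilationParam.eq_1 n]

theorem dilationParam_le_two (n : ℕ) : dilationParam n ≤ 2 := by
  linarith [eps_le_one n, dilationParam.eq_1 n]

theorem tendsto_dilationParam : Tendsto dilationParam atTop (𝓝 1) := by
  have h : Tendsto dilationParam atTop (𝓝 (1 + 0)) := tendsto_eps.const_add 1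
  rwa [add_zero] at h

/-- Dominated convergence. For `r > 1` dilation shrinks supports, so the ball containing the support
of `g` serves for all `n`; the phase tends to zero almost everywhere. -/
theorem IsRegularPotential.tendsto_dilate_of_continuous (hA : IsRegularPotential A a)
    {g : Space d → E} (hg : Continuous g) (hgc : HasCompactSupport g) :
    Tendsto (fun n => eLpNorm (fun x => dilate A (dilationParam n) g x - g x) 2 volume) atTop
      (𝓝 0) := by
  obtain ⟨C, hC⟩ := hgc.exists_bound_of_continuous hg
  obtain ⟨R, hR⟩ := hgc.isBounded.subset_ball (0 : Space d)
  have hC0 : 0 ≤ C := (norm_nonneg _).trans (hC 0)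
  have hz : ∀ x : Space d, x ∉ Metric.ball (0 : Space d) R → g x = 0 := fun x hx =>
    image_eq_zero_of_notMem_tsupport fun h => hx (hR h)
  have hb : MemLp ((Metric.ball (0 : Space d) R).indicator fun _ => √(2 ^ d) * C + C) 2 volume :=
    memLp_indicator_const 2 Metric.isOpen_ball.measurableSet _ (Or.inr measure_ball_lt_top.ne)
  have hpos : ∀ n, 0 < dilationParam n := fun n => one_pos.trans (one_lt_dilationParam n)
  refine tendsto_eLpNorm_sub_of_dominated hb
    (fun n => hA.aestronglyMeasurable_dilate (hpos n) hg.aestronglyMeasurable)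
    hg.aestronglyMeasurable (fun n x => ?_) ?_
  · by_cases hx : x ∈ Metric.ball (0 : Space d) R
    · rw [Set.indicator_of_mem hx]
      refine (norm_sub_le _ _).trans (add_le_add ?_ (hC x))
      rw [norm_dilate]
      refine mul_le_mul (Real.sqrt_le_sqrt ?_) (hC _) (norm_nonneg _) (Real.sqrt_nonneg _)
      exact pow_le_pow_left₀ (hpos n).le (dilationParam_le_two n) d
    · have hx' : dilationParam n • x ∉ Metric.ball (0 : Space d) R := by
        rw [mem_ball_zero_iff, not_lt] at hx ⊢
        rw [norm_smul, Real.norm_of_nonneg (hpos n).le]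
        nlinarith [norm_nonneg x, one_lt_dilationParam n]
      rw [Set.indicator_of_notMem hx, dilate, hz _ hx, hz _ hx']
      simp
  · have ht : Tendsto dilationParam atTop (𝓝[>] 1) :=
      tendsto_nhdsWithin_iff.2 ⟨tendsto_dilationParam,
        Eventually.of_forall fun n => one_lt_dilationParam n⟩
    filter_upwards [hA.tendsto_gaugePhase] with x hx
    have h1 := hx.comp ht
    have h2 : Tendsto (fun n => g (dilationParam n • x)) atTop (𝓝 (g x)) := by
      have h3 : Tendsto (fun n => dilationParam n • x) atTop (𝓝 ((1 : ℝ) • x)) :=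
        tendsto_dilationParam.smul_const x
      rw [one_smul] at h3
      exact (hg.tendsto x).comp h3
    have h4 : Continuous fun p : ℝ × ℝ =>
        (√(p.1 ^ d) : ℂ) * Complex.exp (-(Complex.I * (p.2 : ℂ))) := by fun_prop
    have h5 := ((h4.tendsto (1, 0)).comp (tendsto_dilationParam.prodMk_nhds h1)).smul h2
    simpa [dilate, Function.comp_def] using h5

/-- Strong continuity on a dense set extends to all of `L²` because every dilation preserves `L²`
distances. -/
theorem IsRegularPotential.tendsto_dilateLp (hA : IsRegularPotential A a)
    (f : Lp E 2 (volume : Measure (Space d))) :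
    Tendsto (fun n => dilateLp A (dilationParam n) f) atTop (𝓝 f) := by
  have hpos : ∀ n, 0 < dilationParam n := fun n => one_pos.trans (one_lt_dilationParam n)
  rw [Metric.tendsto_atTop]
  intro ε hε
  obtain ⟨g, hgc, hfg, hg, hgm⟩ := (Lp.memLp f).exists_hasCompactSupport_eLpNorm_sub_le
    (by simp) (ε := ENNReal.ofReal (ε / 4)) (by simpa using hε)
  have h1 := ENNReal.tendsto_nhds_zero.1 (hA.tendsto_dilate_of_continuous hg hgc)
    (ENNReal.ofReal (ε / 4)) (by simpa using hε)
  obtain ⟨N, hN⟩ := eventually_atTop.1 h1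
  refine ⟨N, fun n hn => ?_⟩
  set r := dilationParam n
  have h2 : ‖f - hgm.toLp g‖ ≤ ε / 4 := by
    rw [Lp.norm_def]
    refine ENNReal.toReal_le_of_le_ofReal (by positivity) (le_trans (le_of_eq ?_) hfg)
    refine eLpNorm_congr_ae ?_
    filter_upwards [Lp.coeFn_sub f (hgm.toLp g), hgm.coeFn_toLp] with x h3 h4
    rw [h3, Pi.sub_apply, Pi.sub_apply, h4]
  have h3 : ‖dilateLp A r (hgm.toLp g) - hgm.toLp g‖ ≤ ε / 4 := by
    rw [hA.dilateLp_toLp (hpos n), ← MemLp.toLp_sub, Lp.norm_toLp]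
    exact ENNReal.toReal_le_of_le_ofReal (by positivity) (hN n hn)
  have h4 := hA.norm_dilateLp_sub (hpos n) f (hgm.toLp g)
  have h5 : dilateLp A r f - f = (dilateLp A r f - dilateLp A r (hgm.toLp g)) +
      (dilateLp A r (hgm.toLp g) - hgm.toLp g) - (f - hgm.toLp g) := by abel
  rw [dist_eq_norm, h5]
  have h6 := (norm_sub_le ((dilateLp A r f - dilateLp A r (hgm.toLp g)) +
      (dilateLp A r (hgm.toLp g) - hgm.toLp g)) (f - hgm.toLp g)).trans
    (add_le_add_left (norm_add_le _ _) _)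
  rw [h4] at h6
  linarith

end DilationLp

/-! ### The virial inequality. -/

section Virial

variable {d : ℕ} {A : Space d → Space d} {a : Fin d → Fin d → Space d → ℝ}

/-- The dilate of `u` is an admissible test function in the weak eigenvalue equation `heig`. By the
commutation formula the expression on the left is, up to sign, the pairing of the commutator with
`G`. -/
theorem abs_virial_le_of_bounded (hA : IsRegularPotential A a) {b : ℝ} (hb0 : 0 ≤ b) (hb1 : b < 1)
    (hb : ∀ u G, MemLp u 2 volume → MemLp G 2 volume → HasMagGrad A u G →
      fieldNorm a u ≤ ENNReal.ofReal b * eLpNorm G 2 volume)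
    {ψ : L2 d} {G : L2Vec d} {lam : ℝ}
    (heig : ∀ (u : Space d → ℂ) (K : Space d → EuclideanSpace ℂ (Fin d)) (hu : MemLp u 2 volume)
      (hK : MemLp K 2 volume), HasMagGrad A u K →
      ⟪hK.toLp K, G⟫_ℂ = (lam : ℂ) * ⟪hu.toLp u, ψ⟫_ℂ)
    {u : Space d → ℂ} {K : Space d → EuclideanSpace ℂ (Fin d)} (hu : MemLp u 2 volume)
    (hum : Measurable u) (hK : MemLp K 2 volume) (h : HasMagGrad A u K) {M R : ℝ}
    (hM : ∀ x, ‖u x‖ ≤ M) (hR : ∀ x, R ≤ ‖x‖ → u x = 0) {r₀ : ℝ} (hr₀ : 1 ≤ r₀) (hr₀' : r₀ ≤ 2)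
    {r : ℝ} (hr : r ∈ Set.Icc r₀⁻¹ r₀) :
    |r * (⟪dilateLp A r (hK.toLp K), G⟫_ℂ).re - lam * (⟪dilateLp A r (hu.toLp u), ψ⟫_ℂ).re| ≤
      |r - 1| * (b * r₀ * ‖hK.toLp K‖ / (1 - b * (r₀ - 1))) * ‖G‖ := by
  have hr0 : 0 < r := (inv_pos.2 (by linarith)).trans_le hr.1
  have hden : 0 < 1 - b * (r₀ - 1) := by nlinarith
  have herr := eLpNorm_dilationError_le_of_small hA hb0 hb1 hb hu hum hK h hM hR hr₀ hr₀' hr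
  have hEm : MemLp (dilationError A a r u) 2 volume :=
    ⟨hA.aestronglyMeasurable_dilationError hr0 hu.1, herr.trans_lt ENNReal.ofReal_lt_top⟩
  have hDm := (hA.memLp_dilate hr0 hK).const_smul (r : ℂ)
  have h1 := heig _ _ (hA.memLp_dilate hr0 hu) (hDm.add hEm) (hA.hasMagGrad_dilate hr0 h hM)
  rw [MemLp.toLp_add hDm hEm, MemLp.toLp_const_smul (r : ℂ) (hA.memLp_dilate hr0 hK), ← hA.dilateLp_toLp hr0 hK,
    ← hA.dilateLp_toLp hr0 hu, inner_add_left, inner_smul_left, Complex.conj_ofReal] at h1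
  have h2 := congrArg Complex.re h1
  rw [Complex.add_re, Complex.re_ofReal_mul, Complex.re_ofReal_mul] at h2
  have h3 : r * (⟪dilateLp A r (hK.toLp K), G⟫_ℂ).re -
      lam * (⟪dilateLp A r (hu.toLp u), ψ⟫_ℂ).re = -(⟪hEm.toLp _, G⟫_ℂ).re := by linarith
  rw [h3, abs_neg]
  refine (Complex.abs_re_le_norm _).trans ((norm_inner_le_norm _ _).trans ?_)
  gcongr
  rw [Lp.norm_toLp, Lp.norm_toLp]
  exact ENNReal.toReal_le_of_le_ofReal (by positivity) herr

/-- The approximate virial identity. -/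
theorem abs_virial_le (hA : IsRegularPotential A a) {b : ℝ} (hb0 : 0 ≤ b) (hb1 : b < 1)
    (hb : ∀ u G, MemLp u 2 volume → MemLp G 2 volume → HasMagGrad A u G →
      fieldNorm a u ≤ ENNReal.ofReal b * eLpNorm G 2 volume)
    {ψ : L2 d} {G : L2Vec d} {lam : ℝ} (hG : HasMagGrad A ψ G)
    (heig : ∀ (u : Space d → ℂ) (K : Space d → EuclideanSpace ℂ (Fin d)) (hu : MemLp u 2 volume)
      (hK : MemLp K 2 volume), HasMagGrad A u K →
      ⟪hK.toLp K, G⟫_ℂ = (lam : ℂ) * ⟪hu.toLp u, ψ⟫_ℂ)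
    {r₀ : ℝ} (hr₀ : 1 ≤ r₀) (hr₀' : r₀ ≤ 2) {r : ℝ} (hr : r ∈ Set.Icc r₀⁻¹ r₀) :
    |r * (⟪dilateLp A r G, G⟫_ℂ).re - lam * (⟪dilateLp A r ψ, ψ⟫_ℂ).re| ≤
      |r - 1| * (b * r₀ * ‖G‖ / (1 - b * (r₀ - 1))) * ‖G‖ := by
  have hr0 : 0 < r := (inv_pos.2 (by linarith)).trans_le hr.1
  have hψm := (Lp.stronglyMeasurable ψ).measurable
  have hGm := (Lp.stronglyMeasurable G).measurable
  have hu := fun n => memLp_approx n hψm (Lp.memLp ψ)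
  have hK := fun n => memLp_approxGrad n hψm (Lp.memLp ψ) hGm (Lp.memLp G)
  have hlim : ∀ {E : Type} [NormedAddCommGroup E] (f : Lp E 2 (volume : Measure (Space d)))
      (v : ℕ → Space d → E) (hv : ∀ n, MemLp (v n) 2 volume),
      Tendsto (fun n => eLpNorm (fun x => v n x - f x) 2 volume) atTop (𝓝 0) →
      Tendsto (fun n => (hv n).toLp (v n)) atTop (𝓝 f) := fun f v hv ht => by
    rw [tendsto_iff_norm_sub_tendsto_zero]
    have h1 := (ENNReal.tendsto_toReal ENNReal.zero_ne_top).comp ht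
    rw [ENNReal.toReal_zero] at h1
    refine h1.congr fun n => ?_
    rw [Function.comp, Lp.norm_def]
    congr 1
    refine eLpNorm_congr_ae ?_
    filter_upwards [Lp.coeFn_sub ((hv n).toLp (v n)) f, (hv n).coeFn_toLp] with x h3 h4
    rw [h3, Pi.sub_apply, h4]
  have t1 := hlim ψ _ hu (tendsto_eLpNorm_approx hψm (Lp.memLp ψ))
  have t2 := hlim G _ hK (tendsto_eLpNorm_approxGrad hψm (Lp.memLp ψ) hGm (Lp.memLp G))
  have hcont : ∀ {E : Type} [NormedAddCommGroup E] [InnerProductSpace ℂ E],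
      Continuous (dilateLp A r : Lp E 2 (volume : Measure (Space d)) → Lp E 2 volume) :=
    fun {E} _ _ => (Isometry.of_dist_eq fun f g => by
      rw [dist_eq_norm, dist_eq_norm, hA.norm_dilateLp_sub hr0]).continuous
  have t3 := (((hcont.tendsto ψ).comp t1).inner (tendsto_const_nhds (x := ψ))
    (𝕜 := ℂ))
  have t4 := (((hcont.tendsto G).comp t2).inner (tendsto_const_nhds (x := G))
    (𝕜 := ℂ))
  have t5 := ((((Complex.continuous_re.tendsto _).comp t4).const_mul r).sub
    (((Complex.continuous_re.tendsto _).comp t3).const_mul lam)).abs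
  have t6 := (((t2.norm.const_mul (b * r₀)).div_const (1 - b * (r₀ - 1))).const_mul
    |r - 1|).mul_const ‖G‖
  -- The bound for the approximants involves neither their supremum nor their support, only the norm
  -- of their gradient, so it survives the limit.
  refine le_of_tendsto_of_tendsto' t5 t6 fun n => ?_
  exact abs_virial_le_of_bounded hA hb0 hb1 hb heig (hu n) (measurable_approx n hψm) (hK n)
    (hasMagGrad_approx n hG) (norm_approx_le_nat n ψ) (approx_eq_zero n ψ) hr₀ hr₀' hr

/-- The magnetic gradient of an eigenfunction vanishes if the magnetic field is small. -/
theorem magGrad_eq_zero_of_eigenfunction (hA : IsRegularPotential A a) {b : ℝ} (hb0 : 0 ≤ b)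
    (hb1 : b < 1)
    (hb : ∀ u G, MemLp u 2 volume → MemLp G 2 volume → HasMagGrad A u G →
      fieldNorm a u ≤ ENNReal.ofReal b * eLpNorm G 2 volume)
    {ψ : L2 d} {G : L2Vec d} {lam : ℝ} (hG : HasMagGrad A ψ G)
    (heig : ∀ (u : Space d → ℂ) (K : Space d → EuclideanSpace ℂ (Fin d)) (hu : MemLp u 2 volume)
      (hK : MemLp K 2 volume), HasMagGrad A u K →
      ⟪hK.toLp K, G⟫_ℂ = (lam : ℂ) * ⟪hu.toLp u, ψ⟫_ℂ) : G = 0 := by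
  -- The virial inequality is used at `r` and `1/r` with the same `r₀ = r`. The real parts agree, so
  -- subtraction cancels the eigenvalue term, and `(r - 1) + (1 - 1/r) = r - 1/r` is a common
  -- positive factor.
  have key : ∀ n, (⟪dilateLp A (dilationParam n) G, G⟫_ℂ).re ≤
      b * dilationParam n * ‖G‖ / (1 - b * (dilationParam n - 1)) * ‖G‖ := fun n => by
    have h1 := one_lt_dilationParam n
    have h2 := dilationParam_le_two n
    set r := dilationParam n
    have hr0 : 0 < r := by linarith
    have hinv : r⁻¹ < 1 := inv_lt_one_of_one_lt₀ h1
    have v1 := abs_virial_le hA hb0 hb1 hb hG heig h1.le h2 (r := r) ⟨by linarith, le_rfl⟩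
    have v2 := abs_virial_le hA hb0 hb1 hb hG heig h1.le h2 (r := r⁻¹) ⟨le_rfl, by linarith⟩
    rw [hA.re_inner_dilateLp_inv hr0, hA.re_inner_dilateLp_inv hr0, abs_sub_comm r⁻¹ 1,
      abs_of_pos (a := 1 - r⁻¹) (by linarith)] at v2
    rw [abs_of_pos (a := r - 1) (by linarith)] at v1
    have v3 := (abs_le.1 v1).2
    have v4 := (abs_le.1 v2).1
    have hpos : 0 < r - r⁻¹ := by linarith
    refine le_of_mul_le_mul_left ?_ hpos
    linarith
  have t1 : Tendsto (fun n => (⟪dilateLp A (dilationParam n) G, G⟫_ℂ).re) atTop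
      (𝓝 (⟪G, G⟫_ℂ).re) :=
    (Complex.continuous_re.tendsto _).comp ((hA.tendsto_dilateLp G).inner tendsto_const_nhds)
  have t2 : Tendsto (fun n => b * dilationParam n * ‖G‖ / (1 - b * (dilationParam n - 1)) * ‖G‖)
      atTop (𝓝 (b * 1 * ‖G‖ / (1 - b * (1 - 1)) * ‖G‖)) :=
    (((tendsto_dilationParam.const_mul b).mul_const ‖G‖).div
      (((tendsto_dilationParam.sub_const 1).const_mul b).const_sub 1) (by simp)).mul_const ‖G‖
  have h3 := le_of_tendsto_of_tendsto' t1 t2 key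
  have h4 : (⟪G, G⟫_ℂ).re = ‖G‖ ^ 2 := by
    rw [inner_self_eq_norm_sq_to_K]
    norm_cast
  rw [h4] at h3
  simp only [mul_one, sub_self, mul_zero, sub_zero, div_one] at h3
  rw [← norm_eq_zero]
  refine le_antisymm (not_lt.1 fun hpos => ?_) (norm_nonneg G)
  -- The limit reads `‖G‖² ≤ b ‖G‖²`, and `b < 1`.
  nlinarith [mul_pos (sub_pos.2 hb1) (mul_pos hpos hpos)]

end Virial

/-! ### Passage to a measurable potential and conclusion. -/

section Main

variable {d : ℕ}

theorem HasWeakPartialDeriv.ae_unique {F : Type*} [NormedAddCommGroup F] [NormedSpace ℝ F]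
    [CompleteSpace F] {j : Fin d} {f g g' : Space d → F} (h : HasWeakPartialDeriv j f g)
    (h' : HasWeakPartialDeriv j f g') : g =ᵐ[volume] g' :=
  ae_eq_of_integral_contDiff_smul_eq h.2 h'.2 fun φ hφ hφc =>
    neg_injective ((h.3 φ hφ hφc).symm.trans (h'.3 φ hφ hφc))

theorem AdmissibleExponent.two_le {p : ℝ} (hp : AdmissibleExponent d p) :
    (2 : ℝ≥0∞) ≤ ENNReal.ofReal (2 * p) := by
  rw [show (2 : ℝ≥0∞) = ENNReal.ofReal 2 by simp]
  refine ENNReal.ofReal_le_ofReal ?_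
  rcases hp with ⟨_, rfl⟩ | ⟨_, h⟩ | ⟨h, rfl⟩
  · norm_num
  · linarith
  · have : (3 : ℝ) ≤ d := by exact_mod_cast h
    linarith

theorem AdmissibleExponent.one_le_dim {p : ℝ} (hp : AdmissibleExponent d p) : 1 ≤ d := by
  rcases hp with ⟨h, _⟩ | ⟨h, _⟩ | ⟨h, _⟩ <;> omega

theorem MemLpLoc.mono_exponent {F : Type*} [NormedAddCommGroup F] {f : Space d → F} {q q' : ℝ≥0∞}
    (h : MemLpLoc f q) (hq : q' ≤ q) : MemLpLoc f q' := fun K hK => by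
  have : IsFiniteMeasure ((volume : Measure (Space d)).restrict K) :=
    ⟨by rw [Measure.restrict_apply_univ]; exact hK.measure_lt_top⟩
  exact (h K hK).mono_exponent hq

theorem MemLpLoc.congr_ae {F : Type*} [NormedAddCommGroup F] {f g : Space d → F} {q : ℝ≥0∞}
    (h : MemLpLoc f q) (hfg : f =ᵐ[volume] g) : MemLpLoc g q := fun K hK =>
  (h K hK).ae_eq (ae_restrict_of_ae hfg)

theorem HasMagGrad.congr_ae {A A' : Space d → Space d} (hA : A =ᵐ[volume] A') {u u' : Space d → ℂ}
    (hu : u =ᵐ[volume] u') {G G' : Space d → EuclideanSpace ℂ (Fin d)} (hG : G =ᵐ[volume] G')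
    (h : HasMagGrad A u G) : HasMagGrad A' u' G' := fun j => by
  refine (h j).congr_ae hu ?_
  filter_upwards [hA, hu, hG] with x h1 h2 h3
  rw [h1, h2, h3]

theorem MemW1Loc.hasWeakPartialDeriv {A : Space d → Space d} {q : ℝ≥0∞} (hA : MemW1Loc A q)
    (j k : Fin d) :
    HasWeakPartialDeriv j (fun x => A x k) (weakPartialDeriv j fun x => A x k) := by
  have h : ∃ g, HasWeakPartialDeriv j (fun x => A x k) g :=
    ((hA k).2 j).imp fun _ hg => hg.1
  rw [weakPartialDeriv, dif_pos h]
  exact h.choose_spec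

theorem MemW1Loc.memLpLoc_weakPartialDeriv {A : Space d → Space d} {q : ℝ≥0∞}
    (hA : MemW1Loc A q) (j k : Fin d) : MemLpLoc (weakPartialDeriv j fun x => A x k) q := by
  obtain ⟨g, hg, hgq⟩ := (hA k).2 j
  exact hgq.congr_ae (hg.ae_unique (hA.hasWeakPartialDeriv j k))

/-- A potential in `W^{1,2}_loc` has a measurable representative. -/
theorem MemW1Loc.exists_isRegularPotential {A : Space d → Space d} (hA : MemW1Loc A 2) :
    ∃ (A' : Space d → Space d) (a : Fin d → Fin d → Space d → ℝ), IsRegularPotential A' a ∧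
      A =ᵐ[volume] A' ∧ ∀ j k, weakPartialDeriv j (fun x => A x k) =ᵐ[volume] a j k := by
  have hm1 : ∀ k, AEStronglyMeasurable (fun x => A x k) volume := fun k =>
    (hA.hasWeakPartialDeriv k k).1.aestronglyMeasurable
  have hm2 : ∀ j k, AEStronglyMeasurable (weakPartialDeriv j fun x => A x k) volume := fun j k =>
    (hA.hasWeakPartialDeriv j k).2.aestronglyMeasurable
  refine ⟨fun x => WithLp.toLp 2 fun k => (hm1 k).mk _ x, fun j k => (hm2 j k).mk _,
    ⟨fun k => (hm1 k).stronglyMeasurable_mk.measurable,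
      fun j k => (hm2 j k).stronglyMeasurable_mk.measurable,
      fun j k => (hA.memLpLoc_weakPartialDeriv j k).congr_ae (hm2 j k).ae_eq_mk,
      fun j k => (hA.hasWeakPartialDeriv j k).congr_ae (hm1 k).ae_eq_mk (hm2 j k).ae_eq_mk⟩,
    ?_, fun j k => (hm2 j k).ae_eq_mk⟩
  filter_upwards [ae_all_iff.2 fun k => (hm1 k).ae_eq_mk] with x hx
  ext k
  exact hx k

/-- `B` is antisymmetric, so `xᵀB = -Bx` and the operator norm applies. This links the quantity used
in the virial argument to the hypothesis on `|x| |B|`. -/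
theorem norm_radialVec_le {A : Space d → Space d} {a : Fin d → Fin d → Space d → ℝ}
    (ha : ∀ j k, weakPartialDeriv j (fun x => A x k) =ᵐ[volume] a j k) :
    ∀ᵐ x, ‖radialVec a x‖ ≤ ‖x‖ * magneticTensorNorm A x := by
  filter_upwards [ae_all_iff.2 fun j => ae_all_iff.2 fun k => ha j k] with x hx
  have h : radialVec a x =
      -Matrix.toEuclideanCLM (n := Fin d) (𝕜 := ℝ) (magneticTensor A x) x := by
    ext k
    rw [PiLp.neg_apply, Matrix.ofLp_toEuclideanCLM]
    simp only [radialVec, radialField, Matrix.mulVec, dotProduct, magneticTensor, Matrix.of_apply,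
      hx, ← Finset.sum_neg_distrib]
    exact Finset.sum_congr rfl fun j _ => by ring
  rw [h, norm_neg, mul_comm]
  exact ContinuousLinearMap.le_opNorm _ _

theorem hasMagneticGradient_toLp {A : Space d → Space d} {u : Space d → ℂ}
    {G : Space d → EuclideanSpace ℂ (Fin d)} (hu : MemLp u 2 volume) (hG : MemLp G 2 volume)
    (h : HasMagGrad A u G) : HasMagneticGradient A (hu.toLp u) (hG.toLp G) :=
  h.congr_ae EventuallyEq.rfl hu.coeFn_toLp.symm hG.coeFn_toLp.symm

theorem magneticGradient_apply_of_hasMagGrad {A : Space d → Space d} {u : Space d → ℂ}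
    {G : Space d → EuclideanSpace ℂ (Fin d)} (hu : MemLp u 2 volume) (hG : MemLp G 2 volume)
    (h : HasMagGrad A u G) : ∃ hd : hu.toLp u ∈ (magneticGradient A).domain,
      magneticGradient A ⟨hu.toLp u, hd⟩ = hG.toLp G := by
  have h1 := (mem_magneticGradient_graph_iff A _ _).2 (hasMagneticGradient_toLp hu hG h)
  obtain ⟨y, hy1, hy2⟩ := (LinearPMap.mem_graph_iff _).1 h1
  have hy : (y : L2 d) = hu.toLp u := hy1
  exact ⟨hy ▸ y.2, (congrArg _ (Subtype.ext hy.symm)).trans hy2⟩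

theorem fieldNorm_le_of_smallMagneticField {A A' : Space d → Space d}
    {a : Fin d → Fin d → Space d → ℝ} (hAA : A =ᵐ[volume] A')
    (ha : ∀ j k, weakPartialDeriv j (fun x => A x k) =ᵐ[volume] a j k) {b : ℝ} (hb0 : 0 ≤ b)
    (hb : ∀ ψ : (magneticGradient A).domain,
      ∫⁻ x, ENNReal.ofReal (‖x‖ ^ 2 * magneticTensorNorm A x ^ 2 * ‖(ψ : L2 d) x‖ ^ 2) ≤
        ENNReal.ofReal (b ^ 2) * ∫⁻ x, ENNReal.ofReal (‖magneticGradient A ψ x‖ ^ 2))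
    (u : Space d → ℂ) (G : Space d → EuclideanSpace ℂ (Fin d)) (hu : MemLp u 2 volume)
    (hG : MemLp G 2 volume) (h : HasMagGrad A' u G) :
    fieldNorm a u ≤ ENNReal.ofReal b * eLpNorm G 2 volume := by
  obtain ⟨hd, hgrad⟩ := magneticGradient_apply_of_hasMagGrad hu hG
    (h.congr_ae hAA.symm EventuallyEq.rfl EventuallyEq.rfl)
  have h1 := hb ⟨hu.toLp u, hd⟩
  rw [hgrad] at h1
  rw [← ENNReal.pow_le_pow_left_iff two_ne_zero, fieldNorm_sq, mul_pow, eLpNorm_two_sq,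
    ← ENNReal.ofReal_pow hb0]
  have e : ∀ {E : Type} [NormedAddCommGroup E] (v : E), ENNReal.ofReal (‖v‖ ^ 2) = ‖v‖ₑ ^ 2 :=
    fun v => by rw [ENNReal.ofReal_pow (norm_nonneg _), ofReal_norm]
  refine le_trans (lintegral_mono_ae ?_) (h1.trans (le_of_eq ?_))
  · filter_upwards [norm_radialVec_le ha, hu.coeFn_toLp] with x h2 h3
    rw [h3, ← e, ← e, ← ENNReal.ofReal_mul (by positivity), ← mul_pow ‖x‖]
    gcongr
  · congr 1
    refine lintegral_congr_ae ?_
    filter_upwards [hG.coeFn_toLp] with x hx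
    rw [hx, e]

/-- A magnetic Laplacian with a small magnetic field has no eigenvalues. -/
theorem pointSpectrum_magneticLaplacian_eq_empty {A : Space d → Space d} {p : ℝ}
    (hp : AdmissibleExponent d p) (hA : MemW1Loc A (ENNReal.ofReal (2 * p)))
    (hB : SmallMagneticField A) : pointSpectrum (magneticLaplacian A) = ∅ := by
  -- `2p ≥ 2` and compact sets have finite measure, so `A` lies in `W^{1,2}_loc`, the regularity on
  -- which the dilation argument runs.
  have hA2 : MemW1Loc A 2 := fun k => ⟨(hA k).1.mono_exponent hp.two_le, fun j =>
    ((hA k).2 j).imp fun g hg => ⟨hg.1, hg.2.mono_exponent hp.two_le⟩⟩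
  obtain ⟨A', a, hreg, hAA, ha⟩ := hA2.exists_isRegularPotential
  obtain ⟨b, hb0, hb1, hb⟩ := hB
  refine Set.eq_empty_of_forall_notMem fun lam => ?_
  rintro ⟨Ψ, hΨ0, hΨ⟩
  set ψ : L2 d := (Ψ : L2 d) with hψdef
  have hgraph : (ψ, lam • ψ) ∈ (magneticLaplacian A).graph :=
    (LinearPMap.mem_graph_iff _).2 ⟨Ψ, rfl, hΨ⟩
  obtain ⟨hψ, heq⟩ := (mem_magneticLaplacian_graph_iff (fun k => (hA2 k).1) _ _).1 hgraph
  set G := magneticGradient A ⟨ψ, hψ⟩ with hG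
  have hGrad : HasMagGrad A ψ G :=
    (mem_magneticGradient_graph_iff A ψ G).1 ((LinearPMap.mem_graph_iff _).2 ⟨⟨ψ, hψ⟩, rfl, rfl⟩)
  have hself := heq ⟨ψ, hψ⟩
  simp only [inner_smul_right] at hself
  rw [← hG, inner_self_eq_norm_sq_to_K, inner_self_eq_norm_sq_to_K] at hself
  have hψn : ‖ψ‖ ≠ 0 := norm_ne_zero_iff.2 hΨ0
  -- Testing with `ψ` itself shows that the eigenvalue is real, as the virial inequality requires
  -- when real parts are taken.
  have hlam : lam = ((‖G‖ ^ 2 / ‖ψ‖ ^ 2 : ℝ) : ℂ) := by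
    have hψc : (‖ψ‖ : ℂ) ≠ 0 := by exact_mod_cast hψn
    push_cast
    rw [eq_div_iff (pow_ne_zero 2 hψc)]
    exact hself.symm
  have hG0 : G = 0 := by
    refine magGrad_eq_zero_of_eigenfunction hreg hb0 hb1
      (fieldNorm_le_of_smallMagneticField hAA ha hb0 hb) (lam := ‖G‖ ^ 2 / ‖ψ‖ ^ 2) (ψ := ψ)
      (hGrad.congr_ae hAA EventuallyEq.rfl EventuallyEq.rfl) fun u K hu hK h => ?_
    obtain ⟨hd, hgrad⟩ := magneticGradient_apply_of_hasMagGrad hu hK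
      (h.congr_ae hAA.symm EventuallyEq.rfl EventuallyEq.rfl)
    rw [← hgrad, ← hlam, ← inner_smul_right]
    exact heq ⟨_, hd⟩
  refine hΨ0 ((Lp.eq_zero_iff_ae_eq_zero).2 ?_)
  exact hGrad.ae_eq_zero hp.one_le_dim (Lp.memLp ψ) ((Lp.eq_zero_iff_ae_eq_zero).1 hG0)

end Main

end MagneticLaplacian

end

theorem mainTheorem3 (d : ℕ) (p : ℝ) (hp : MagneticLaplacian.AdmissibleExponent d p)
    (A : MagneticLaplacian.Space d → MagneticLaplacian.Space d)
    (hA : MagneticLaplacian.MemW1Loc A (ENNReal.ofReal (2 * p)))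
    (hB : MagneticLaplacian.SmallMagneticField A) :
    MagneticLaplacian.pointSpectrum (MagneticLaplacian.magneticLaplacian A) = ∅ :=
  MagneticLaplacian.pointSpectrum_magneticLaplacian_eq_empty hp hA hB
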